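/- Let $\Omega\subset\mathbb{R}^3$ be a bounded domain with a $C^2$ boundary, $\Omega^c=\mathbb{R}^3\setminus\overline{\Omega}$, $\nu$ the unit outer normal of $\partial\Omega$, $\lambda,\kappa>0$, $0<\alpha<1$, and let $\mathcal{H}^e:\mathbb{R}^3\to\mathbb{R}^3$ satisfy $\mathcal{H}^e\in C^{2+\alpha}_{\rm loc}(\Omega^c,\mathbb{R}^3)\cap C^{1+\alpha}_{\rm loc}(\overline{\Omega^c},\mathbb{R}^3)$, $\operatorname{curl}\mathcal{H}^e=\mathbf 0$ and $\operatorname{div}\mathcal{H}^e=0$ in $\Omega^c$, and $\int_{\partial\Omega}\nu\cdot\mathcal{H}^e\,dS=0$. Let $\mathcal{A}(\Omega)$ be the set of $\mathbf{A}\in L^2_{\rm loc}(\mathbb{R}^3,\mathbb{R}^3)$ with weak curl in $L^2_{\rm loc}(\mathbb{R}^3,\mathbb{R}^3)$ and $\mathbf{A}\in L^\infty(\Omega,\mathbb{R}^3)$, and let $\mathcal{B}(\Omega)$ be the set of $\mathbf{B}\in\mathcal{A}(\Omega)$ such that $\operatorname{curl}\mathbf{B}\in L^2(\mathbb{R}^3,\mathbb{R}^3)$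 and the outer tangential trace $\mathbf{B}_T^+$ on $\partial\Omega$ (the trace from $\Omega^c$) lies in $H^{1/2}(\partial\Omega,\mathbb{R}^3)$. A pair $(f,\mathbf{A})$ is called a weak Meissner solution of the Meissner system $$\begin{cases}-\frac{\lambda^2}{\kappa^2}\Delta f=(1-f^2-|\mathbf{A}|^2)f,\quad \lambda^2\operatorname{curl}^2\mathbf{A}+f^2\mathbf{A}=\mathbf 0 & \text{in }\Omega,\\ \operatorname{curl}^2\mathbf{A}=\mathbf 0 & \text{in }\Omega^c,\\ \frac{\partial f}{\partial\nu}=0,\quad [\mathbf{A}_T]=\mathbf 0,\quad [(\operatorname{curl}\mathbf{A})_T]=\mathbf 0 & \text{on }\partial\Omega,\end{cases}\qquad \lambda\operatorname{curl}\mathbf{A}-\mathcal{H}^e\to\mathbf 0\ \text{ as }|x|\to\infty,$$ (where $[\cdot]$ is the jump across $\partial\Omega$) if 1. $f\in H^1(\Omega)$, $\mathbf{A}\in\mathcal{A}(\Omega)$ and $\operatorname{curl}\mathbf{A}-\lambda^{-1}\mathcal{H}^e\in L^2(\mathbb{R}^3,\mathbb{R}^3)$; 2. for all $g\in H^1(\Omega)$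 and $\mathbf{B}\in\mathcal{B}(\Omega)$, $$\int_\Omega\Big\{\frac{\lambda^2}{\kappa^2}\nabla f\cdot\nabla g-(1-f^2-|\mathbf{A}|^2)fg+f^2\mathbf{A}\cdot\mathbf{B}\Big\}dx+\int_{\mathbb{R}^3}\lambda(\lambda\operatorname{curl}\mathbf{A}-\mathcal{H}^e)\cdot\operatorname{curl}\mathbf{B}\,dx=0;$$ 3. $f>0$ on $\overline{\Omega}$, and the inner normal trace $\nu\cdot\mathbf{A}^-$ on $\partial\Omega$ (the trace from $\Omega$) vanishes in $H^{-1/2}(\partial\Omega)$. Suppose that $(f_0,\mathbf{A}_0)$ and $(f_1,\mathbf{A}_1)$ are two weak Meissner solutions (for the same $\Omega,\lambda,\kappa,\mathcal{H}^e$) which both satisfy $$\inf_{x\in\overline{\Omega}}\{f_j^2(x)-|\mathbf{A}_j(x)|^2\}>\tfrac13,\qquad j=0,1.$$ Then $$(f_0,\mathbf{A}_0)=(f_1,\mathbf{A}_1)\ \text{ a.e. in }\Omega,\qquad \operatorname{curl}\mathbf{A}_0=\operatorname{curl}\mathbf{A}_1\ \text{ a.e. in }\Omega^c.$$ Here pointwise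 conditions on $f_j,\mathbf{A}_j$ over $\overline{\Omega}$ are understood up to null sets, with the essential infimum over $\Omega$. -/

import Mathlib

open MeasureTheory

noncomputable section

namespace Meissner

/-- Three-dimensional Euclidean space. -/
abbrev E3 : Type := EuclideanSpace ℝ (Fin 3)

/-- The exterior region `Ω^c = ℝ³ \ closure Ω` (an open set). -/
def exterior (Ω : Set E3) : Set E3 := (closure Ω)ᶜ

/-! ### Classical differential operators -/

/-- The partial derivative `∂_j F_i`. -/
def pderiv (j i : Fin 3) (F : E3 → E3) (x : E3) : ℝ :=
  (fderiv ℝ F x (EuclideanSpace.single j 1)) i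

/-- The classical curl of a differentiable vector field. -/
def curl (F : E3 → E3) (x : E3) : E3 :=
  !₂[pderiv 1 2 F x - pderiv 2 1 F x,
     pderiv 2 0 F x - pderiv 0 2 F x,
     pderiv 0 1 F x - pderiv 1 0 F x]

/-- The classical divergence of a differentiable vector field. -/
def divg (F : E3 → E3) (x : E3) : ℝ := ∑ i, pderiv i i F x

/-! ### Domains with `C²` boundary -/

/-- `ρ` is a `C²` defining function of `Ω` in the open set `U`: `Ω ∩ U = {ρ < 0} ∩ U` and the
gradient of `ρ` does not vanish in `U`. (Hence `∂Ω ∩ U = {ρ = 0} ∩ U`, and `Ω` lies locally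
on one side of `∂Ω`.) -/
structure IsDefiningFunction (Ω U : Set E3) (ρ : E3 → ℝ) : Prop where
  isOpen : IsOpen U
  contDiffOn : ContDiffOn ℝ 2 ρ U
  gradient_ne_zero : ∀ x ∈ U, gradient ρ x ≠ 0
  mem_iff : ∀ x ∈ U, (x ∈ Ω ↔ ρ x < 0)

/-- The boundary of `Ω` is of class `C²`. -/
def HasC2Boundary (Ω : Set E3) : Prop :=
  ∀ p ∈ frontier Ω, ∃ U ρ, p ∈ U ∧ IsDefiningFunction Ω U ρ

/-- A bounded domain (non-empty connected open set) with a `C²` boundary. -/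
structure IsBoundedC2Domain (Ω : Set E3) : Prop where
  isOpen : IsOpen Ω
  isConnected : IsConnected Ω
  isBounded : Bornology.IsBounded Ω
  c2Boundary : HasC2Boundary Ω

/-- `n` is the unit normal of `∂Ω` at `p` that points out of `Ω`. -/
def IsOuterUnitNormal (Ω : Set E3) (p n : E3) : Prop :=
  ∃ U ρ, p ∈ U ∧ IsDefiningFunction Ω U ρ ∧ n = ‖gradient ρ p‖⁻¹ • gradient ρ p

open Classical in
/-- The unit outer normal `ν` on `∂Ω` (for a `C²` boundary it exists and is unique). -/
def outerUnitNormal (Ω : Set E3) (p : E3) : E3 :=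
  if h : ∃ n, IsOuterUnitNormal Ω p n then h.choose else 0

/-! ### The condition on the applied field -/

/-- `H ∈ C^{2+α}_loc(Ω^c, curl 0, div 0) ∩ C^{1+α}_loc(closure of Ω^c, ℝ³)` with zero flux through
`∂Ω`. The surface integral is with respect to the two-dimensional Hausdorff measure, which is a
constant multiple of the surface measure. -/
structure AppliedFieldCondition (Ω : Set E3) (α : NNReal) (H : E3 → E3) : Prop where
  /-- two continuous derivatives in the open set `Ω^c` -/
  contDiffOn : ContDiffOn ℝ 2 H (exterior Ω)
  /-- the second derivatives are `α`-Hölder continuous on compact subsets of `Ω^c` -/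
  holder_second : ∀ K, IsCompact K → K ⊆ exterior Ω →
    ∃ C, HolderOnWith C α (iteratedFDeriv ℝ 2 H) K
  curl_eq_zero : ∀ x ∈ exterior Ω, curl H x = 0
  div_eq_zero : ∀ x ∈ exterior Ω, divg H x = 0
  /-- continuity up to the boundary; the values on `∂Ω` are those of the outer trace -/
  continuousOn : ContinuousOn H (closure (exterior Ω))
  /-- the first derivatives are `α`-Hölder continuous up to the boundary, on bounded sets -/
  holder_first : ∀ R : ℝ, ∃ C,
    HolderOnWith C α (fderiv ℝ H) (exterior Ω ∩ Metric.ball 0 R)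
  flux_eq_zero :
    ∫ x in frontier Ω, inner ℝ (outerUnitNormal Ω x) (H x) ∂(Measure.hausdorffMeasure 2) = 0

/-! ### Weak derivatives and function spaces -/

/-- `φ ∈ C_c^∞(D, F)`. -/
def IsTestFunction {F : Type*} [NormedAddCommGroup F] [NormedSpace ℝ F]
    (D : Set E3) (φ : E3 → F) : Prop :=
  ContDiff ℝ (⊤ : ℕ∞) φ ∧ HasCompactSupport φ ∧ tsupport φ ⊆ D

/-- `G` is the weak gradient of `f` in the open set `D`. -/
structure IsWeakGrad (D : Set E3) (f : E3 → ℝ) (G : E3 → E3) : Prop where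
  locInt : LocallyIntegrableOn f D
  locInt_grad : LocallyIntegrableOn G D
  integral_eq : ∀ φ : E3 → ℝ, IsTestFunction D φ → ∀ i : Fin 3,
    ∫ x in D, f x * fderiv ℝ φ x (EuclideanSpace.single i 1) = -∫ x in D, G x i * φ x

open Classical in
/-- The weak gradient of `f` in `D`, unique up to null sets (and `0` if there is none). -/
def weakGrad (D : Set E3) (f : E3 → ℝ) : E3 → E3 :=
  if h : ∃ G, IsWeakGrad D f G then h.choose else 0

/-- The Sobolev space `H¹(D)`. -/
structure MemH1 (D : Set E3) (f : E3 → ℝ) : Prop where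
  memLp : MemLp f 2 (volume.restrict D)
  exists_weakGrad : ∃ G, IsWeakGrad D f G
  memLp_weakGrad : MemLp (weakGrad D f) 2 (volume.restrict D)

/-- `C` is the weak curl of the vector field `A` in `ℝ³`. -/
structure IsWeakCurl (A C : E3 → E3) : Prop where
  locInt : LocallyIntegrable A
  locInt_curl : LocallyIntegrable C
  integral_eq : ∀ φ : E3 → E3, IsTestFunction Set.univ φ →
    ∫ x, inner ℝ (A x) (curl φ x) = ∫ x, inner ℝ (C x) (φ x)

open Classical in
/-- The weak curl of `A` in `ℝ³`, unique up to null sets (and `0` if there is none). -/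
def weakCurl (A : E3 → E3) : E3 → E3 :=
  if h : ∃ C, IsWeakCurl A C then h.choose else 0

/-- `L²_loc(ℝ³, ℝ³)`. -/
def MemL2Loc (A : E3 → E3) : Prop :=
  ∀ K, IsCompact K → MemLp A 2 (volume.restrict K)

/-- `A ∈ 𝓐(Ω, ℝ³)`: `A ∈ L²_loc(ℝ³)` and `curl A ∈ L²_loc(ℝ³)`, and `A` is bounded in `Ω`. -/
structure MemA (Ω : Set E3) (A : E3 → E3) : Prop where
  memL2Loc : MemL2Loc A
  exists_weakCurl : ∃ C, IsWeakCurl A C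
  memL2Loc_curl : MemL2Loc (weakCurl A)
  bounded : MemLp A ⊤ (volume.restrict Ω)

/-- `A ∈ 𝓐(Ω, ℝ³, F)`: in addition `curl A - F ∈ L²(ℝ³)`. -/
structure MemAWith (Ω : Set E3) (F A : E3 → E3) : Prop extends MemA Ω A where
  memLp_sub : MemLp (fun x => weakCurl A x - F x) 2 volume

/-! ### Traces -/

/-- The pairing of the outer tangential trace of `B ∈ H_loc(ℝ³, curl)` on `∂Ω` with the test field
`φ`, given by Green's formula in `Ω^c`; with the normal `ν` pointing into `Ω^c`,
it equals `-∫_{∂Ω} (ν × B⁺) · φ dS` for regular `B`. -/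
def outerTangentialTrace (Ω : Set E3) (B φ : E3 → E3) : ℝ :=
  ∫ x in exterior Ω, (inner ℝ (weakCurl B x) (φ x) - inner ℝ (B x) (curl φ x))

/-- `B_T⁺ ∈ TH^{1/2}(∂Ω, ℝ³)`. As `H^{1/2}(∂Ω, ℝ³)` is the space of traces of fields in
`H¹(ℝ³, ℝ³)`, this says that `B` has the same outer tangential trace as some field
`U ∈ H¹(ℝ³, ℝ³)`. -/
def OuterTangentialTraceMemTH (Ω : Set E3) (B : E3 → E3) : Prop :=
  ∃ U : E3 → E3, (∀ i : Fin 3, MemH1 Set.univ (fun x => U x i)) ∧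
    ∀ φ : E3 → E3, IsTestFunction Set.univ φ →
      outerTangentialTrace Ω B φ = outerTangentialTrace Ω U φ

/-- `ν · A⁻ = 0` on `∂Ω` in `H^{-1/2}(∂Ω)`: the field `A` has a weak divergence `d ∈ L²(Ω)`, and its
inner normal trace, which is the functional `φ ↦ ∫_Ω (A · ∇φ + φ div A)` on `H¹(Ω)` by Green's
formula, vanishes. -/
def InnerNormalTraceEqZero (Ω : Set E3) (A : E3 → E3) : Prop :=
  ∃ d : E3 → ℝ, MemLp A 2 (volume.restrict Ω) ∧ MemLp d 2 (volume.restrict Ω) ∧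
    (∀ φ : E3 → ℝ, IsTestFunction Ω φ →
      ∫ x in Ω, inner ℝ (A x) (gradient φ x) = -∫ x in Ω, d x * φ x) ∧
    ∀ φ : E3 → ℝ, MemH1 Ω φ →
      ∫ x in Ω, (inner ℝ (A x) (weakGrad Ω φ x) + d x * φ x) = 0

/-- `B ∈ 𝓑(Ω, ℝ³)`, the space of test fields. -/
structure MemB (Ω : Set E3) (B : E3 → E3) : Prop extends MemA Ω B where
  memLp_curl : MemLp (weakCurl B) 2 volume
  trace : OuterTangentialTraceMemTH Ω B

/-! ### Weak solutions -/

/-- `(f, A)` is a weak solution of the Meissner system with applied field `H`, including the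
condition at infinity `λ curl A - H → 0`. -/
structure IsWeakSolution (Ω : Set E3) (lam κ : ℝ) (H : E3 → E3) (f : E3 → ℝ) (A : E3 → E3) :
    Prop where
  memH1 : MemH1 Ω f
  memA : MemAWith Ω (fun x => lam⁻¹ • H x) A
  weak_eq : ∀ (g : E3 → ℝ) (B : E3 → E3), MemH1 Ω g → MemB Ω B →
    (∫ x in Ω, (lam ^ 2 / κ ^ 2 * inner ℝ (weakGrad Ω f x) (weakGrad Ω g x)
        - (1 - f x ^ 2 - ‖A x‖ ^ 2) * f x * g x + f x ^ 2 * inner ℝ (A x) (B x)))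
      + ∫ x, lam * inner ℝ (lam • weakCurl A x - H x) (weakCurl B x) = 0

/-- A weak Meissner solution: moreover `f > 0` on the closed set `closure Ω`, that is `f` has a
positive essential lower bound in `Ω`, and the inner normal trace of `A` vanishes. -/
structure IsWeakMeissnerSolution (Ω : Set E3) (lam κ : ℝ) (H : E3 → E3) (f : E3 → ℝ)
    (A : E3 → E3) : Prop extends IsWeakSolution Ω lam κ H f A where
  pos : ∃ c > 0, ∀ᵐ x ∂(volume.restrict Ω), c ≤ f x
  normalTrace : InnerNormalTraceEqZero Ω A

/-- `inf (f² - |A|²) > 1/3` over `closure Ω`, as an essential infimum (`∂Ω` is a null set). -/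
def StabilityCondition (Ω : Set E3) (f : E3 → ℝ) (A : E3 → E3) : Prop :=
  ∃ c > (1 / 3 : ℝ), ∀ᵐ x ∂(volume.restrict Ω), c ≤ f x ^ 2 - ‖A x‖ ^ 2

end Meissner

end

/-!
Test the difference of the two weak equations with `(f₁ - f₀, A₁ - A₀)`. This gives
`λ²/κ² ∫_Ω |∇(f₁ - f₀)|² + ∫_Ω (DV(f₁, A₁) - DV(f₀, A₀))(f₁ - f₀, A₁ - A₀)
  + λ² ∫ |curl (A₁ - A₀)|² = 0`, where `V(f, a) = (1 - f²)²/4 + f²|a|²/2`. As the set where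
`f > 0` and `f² - |a|² > 1/3` is convex, it contains the midpoint of the two states, and this makes
the increment of `DV` a sum of nonnegative terms that vanishes only if the states agree.

Two points need work. The field `A₁ - A₀` need not satisfy the trace condition on test fields, so it
is mollified first; curl commutes with mollification. And the increment of `DV` is integrable only
because `f ∈ L⁴(Ω)`, which follows from Fatou's lemma on testing the equation for `f` with the
truncations `f / (1 + ε f²)`.
-/

noncomputable section

namespace Meissner

open Filter Topology ContinuousLinearMap
open scoped Convolution ENNReal RealInnerProductSpace

/-! ### Mollification -/

section Average

variable {G : Type*} [AddCommGroup G] [MeasurableSpace G] [MeasurableAdd₂ G] [MeasurableNeg G]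
  {μ : Measure G} [SFinite μ] [μ.IsAddLeftInvariant]
  {F : Type*} [NormedAddCommGroup F] [NormedSpace ℝ F] {p : ℝ≥0∞}

lemma eLpNorm_integral_comp_sub_le (hp : 1 ≤ p) (hp' : p ≠ ⊤) {ν : Measure G}
    [IsProbabilityMeasure ν] (hν : ν ≪ μ) {u : G → F} (hu : AEStronglyMeasurable u μ) :
    eLpNorm (fun x => ∫ y, u (x - y) ∂ν) p μ ≤ eLpNorm u p μ := by
  have hp0 : p ≠ 0 := (one_pos.trans_le hp).ne'
  have hr : 0 < p.toReal := ENNReal.toReal_pos hp0 hp'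
  have jensen (x : G) : ‖∫ y, u (x - y) ∂ν‖ₑ ^ p.toReal ≤ ∫⁻ y, ‖u (x - y)‖ₑ ^ p.toReal ∂ν := by
    have hux : AEStronglyMeasurable (fun y => u (x - y)) ν :=
      (hu.comp_quasiMeasurePreserving (quasiMeasurePreserving_sub_left μ x)).mono_ac hν
    have h : ‖∫ y, u (x - y) ∂ν‖ₑ ≤ eLpNorm (fun y => u (x - y)) p ν :=
      (enorm_integral_le_lintegral_enorm _).trans <| eLpNorm_one_eq_lintegral_enorm.symm.trans_le
        (eLpNorm_le_eLpNorm_of_exponent_le hp hux)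
    rwa [eLpNorm_eq_lintegral_rpow_enorm_toReal hp0 hp', one_div,
      ENNReal.le_rpow_inv_iff hr] at h
  have hmeas : AEMeasurable (Function.uncurry fun x y => ‖u (x - y)‖ₑ ^ p.toReal) (μ.prod ν) :=
    ((hu.comp_quasiMeasurePreserving (quasiMeasurePreserving_sub μ μ)).enorm.pow_const _).mono_ac
      (Measure.AbsolutelyContinuous.rfl.prod hν)
  rw [eLpNorm_eq_lintegral_rpow_enorm_toReal hp0 hp',
    eLpNorm_eq_lintegral_rpow_enorm_toReal hp0 hp']
  gcongr ?_ ^ _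
  calc ∫⁻ x, ‖∫ y, u (x - y) ∂ν‖ₑ ^ p.toReal ∂μ
      ≤ ∫⁻ x, ∫⁻ y, ‖u (x - y)‖ₑ ^ p.toReal ∂ν ∂μ := lintegral_mono jensen
    _ = ∫⁻ y, ∫⁻ x, ‖u (x - y)‖ₑ ^ p.toReal ∂μ ∂ν := lintegral_lintegral_swap hmeas
    _ = ∫⁻ _, ∫⁻ x, ‖u x‖ₑ ^ p.toReal ∂μ ∂ν := lintegral_congr fun y =>
        lintegral_sub_right_eq_self (fun x => ‖u x‖ₑ ^ p.toReal) y
    _ = ∫⁻ x, ‖u x‖ₑ ^ p.toReal ∂μ := by simp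

end Average

lemma exists_bump_tendsto_zero (G : Type*) [NormedAddCommGroup G] : ∃ φ : ℕ → ContDiffBump (0 : G),
    Tendsto (fun n => (φ n).rOut) atTop (𝓝 0) ∧ ∀ n, (φ n).rOut ≤ 2 * (φ n).rIn := by
  have hlt (n : ℕ) : 1 / (2 * ((n : ℝ) + 1)) < 1 / (n + 1) := by
    gcongr
    linarith [n.cast_nonneg (α := ℝ)]
  refine ⟨fun n => ⟨1 / (2 * (n + 1)), 1 / (n + 1), by positivity, hlt n⟩,
    tendsto_one_div_add_atTop_nhds_zero_nat, fun n => le_of_eq ?_⟩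
  field_simp

section Mollification

variable {G : Type*} [NormedAddCommGroup G] [NormedSpace ℝ G] [HasContDiffBump G] [MeasureSpace G]
  {F : Type*} [NormedAddCommGroup F] [NormedSpace ℝ F]

/-- The mollification of `u` with the kernel obtained by normalizing the bump function `φ`. -/
def mollify (φ : ContDiffBump (0 : G)) (u : G → F) : G → F :=
  φ.normed volume ⋆[lsmul ℝ ℝ] u

variable {φ : ContDiffBump (0 : G)} {u v : G → F}

lemma mollify_apply (x : G) : mollify φ u x = ∫ y, φ.normed volume y • u (x - y) := rfl

variable [BorelSpace G] [FiniteDimensional ℝ G] [(volume : Measure G).IsAddHaarMeasure]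

lemma mollify_apply_swap (x : G) : mollify φ u x = ∫ y, φ.normed volume (x - y) • u y := by
  rw [mollify, convolution_eq_swap]
  rfl

lemma mollify_eq_of_eqOn_ball {x : G} (h : Set.EqOn u v (Metric.ball x φ.rOut)) :
    mollify φ u x = mollify φ v x := by
  rw [mollify_apply_swap, mollify_apply_swap]
  congr! 2 with y
  by_cases hy : y ∈ Metric.ball x φ.rOut
  · rw [h hy]
  · have : x - y ∉ Function.support (φ.normed volume) := by
      rwa [φ.support_normed_eq, mem_ball_zero_iff, ← dist_eq_norm, dist_comm]
    simp [Function.notMem_support.1 this]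

lemma contDiff_mollify (hu : LocallyIntegrable u) : ContDiff ℝ (⊤ : ℕ∞) (mollify φ u) :=
  φ.hasCompactSupport_normed.contDiff_convolution_left _ φ.contDiff_normed hu

lemma mollify_sub (hu : LocallyIntegrable u) (hv : LocallyIntegrable v) :
    mollify φ (u - v) = mollify φ u - mollify φ v := by
  have hint {w : G → F} (hw : LocallyIntegrable w) (x : G) :
      Integrable fun y => φ.normed volume y • w (x - y) :=
    (φ.hasCompactSupport_normed.convolutionExists_left (μ := volume) (lsmul ℝ ℝ)
      φ.continuous_normed hw) x
  ext x
  simp only [Pi.sub_apply, mollify_apply, smul_sub]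
  exact integral_sub (hint hu x) (hint hv x)

lemma fderiv_mollify [CompleteSpace F] {E : Type*} [NormedAddCommGroup E] [NormedSpace ℝ E]
    [CompleteSpace E] (L : (G →L[ℝ] F) →L[ℝ] E) (hu : LocallyIntegrable u) (x : G) :
    L (fderiv ℝ (mollify φ u) x)
      = -∫ y, L ((fderiv ℝ (fun z => φ.normed volume (x - z)) y).smulRight (u y)) := by
  have hφ : ContDiff ℝ 1 (φ.normed volume) := φ.contDiff_normed
  have hderiv := φ.hasCompactSupport_normed.hasFDerivAt_convolution_left (lsmul ℝ ℝ) hφ hu x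
  have hint := ((φ.hasCompactSupport_normed.fderiv ℝ).convolutionExists_left
    ((lsmul ℝ ℝ : ℝ →L[ℝ] F →L[ℝ] F).precompL G) (hφ.continuous_fderiv one_ne_zero) hu
    x).integrable_swap
  have hkernel (y : G) : fderiv ℝ (fun z => φ.normed volume (x - z)) y
      = -fderiv ℝ (φ.normed volume) (x - y) := by
    have h := (hφ.differentiable one_ne_zero (x - y)).hasFDerivAt.comp y
      ((hasFDerivAt_id y).const_sub x)
    exact h.fderiv.trans (by ext; simp)
  rw [mollify, hderiv.fderiv, convolution_eq_swap, ← L.integral_comp_comm hint, ← integral_neg]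
  congr! 2 with y
  rw [← map_neg, hkernel]
  congr 1
  ext v
  simp [precompL_apply]

variable {p : ℝ≥0∞}

lemma eLpNorm_mollify_le (hp : 1 ≤ p) (hp' : p ≠ ⊤) (hu : AEStronglyMeasurable u volume) :
    eLpNorm (mollify φ u) p volume ≤ eLpNorm u p volume := by
  set w : G → NNReal := fun y => (φ.normed volume y).toNNReal
  have hw : Measurable w := φ.continuous_normed.measurable.real_toNNReal
  have : IsProbabilityMeasure (volume.withDensity fun y => (w y : ℝ≥0∞)) := by
    refine ⟨?_⟩
    rw [withDensity_apply _ .univ, Measure.restrict_univ]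
    change ∫⁻ y, ENNReal.ofReal (φ.normed volume y) = 1
    rw [← ofReal_integral_eq_lintegral_ofReal φ.integrable_normed (ae_of_all _ φ.nonneg_normed),
      φ.integral_normed, ENNReal.ofReal_one]
  have hmollify : mollify φ u =
      fun x => ∫ y, u (x - y) ∂volume.withDensity fun y => (w y : ℝ≥0∞) := by
    ext x
    rw [integral_withDensity_eq_integral_smul hw, mollify_apply]
    simp only [w, NNReal.smul_def, Real.coe_toNNReal _ (φ.nonneg_normed _)]
  rw [hmollify]
  exact eLpNorm_integral_comp_sub_le hp hp' (withDensity_absolutelyContinuous volume _) hu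

lemma memLp_mollify (hp : 1 ≤ p) (hp' : p ≠ ⊤) (hu : MemLp u p) : MemLp (mollify φ u) p :=
  ⟨(contDiff_mollify (hu.locallyIntegrable hp)).continuous.aestronglyMeasurable,
    (eLpNorm_mollify_le hp hp' hu.1).trans_lt hu.2⟩

variable {ι : Type*} {l : Filter ι} {φ : ι → ContDiffBump (0 : G)} [CompleteSpace F]

lemma tendsto_eLpNorm_mollify_sub_of_continuous (hφ : Tendsto (fun i => (φ i).rOut) l (𝓝 0))
    (hp' : p ≠ ⊤) (hc : Continuous u) (hs : HasCompactSupport u) :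
    Tendsto (fun i => eLpNorm (mollify (φ i) u - u) p volume) l (𝓝 0) := by
  set K : Set G := Metric.cthickening 1 (tsupport u)
  have hKc : IsCompact K := hs.isCompact.cthickening
  have hsupp {i : ι} (hi : (φ i).rOut < 1) : (mollify (φ i) u).support ⊆ K := by
    intro x hx
    by_contra hxK
    refine hx ((mollify_eq_of_eqOn_ball (v := 0) fun y hy => ?_).trans (by simp [mollify_apply]))
    refine image_eq_zero_of_notMem_tsupport fun hyu => hxK ?_
    exact Metric.mem_cthickening_of_dist_le x y 1 _ hyu
      (((Metric.mem_ball'.1 hy).trans hi).le)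
  have hK : Tendsto (fun δ : ℝ => ENNReal.ofReal δ * volume K ^ (1 / p.toReal)) (𝓝[>] 0) (𝓝 0) := by
    have hfin : volume K ^ (1 / p.toReal) ≠ ⊤ := by simp [hKc.measure_lt_top.ne]
    simpa only [zero_mul] using ENNReal.Tendsto.mul_const ((ENNReal.continuous_ofReal.tendsto' 0 0
      ENNReal.ofReal_zero).mono_left nhdsWithin_le_nhds) (.inr hfin)
  rw [ENNReal.tendsto_nhds_zero]
  intro ε hε
  obtain ⟨δ, hδε, hδ⟩ :=
    ((ENNReal.tendsto_nhds_zero.1 hK ε hε).and self_mem_nhdsWithin).exists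
  obtain ⟨r, hr, hru⟩ :=
    Metric.uniformContinuous_iff.1 (hs.uniformContinuous_of_continuous hc) δ hδ
  filter_upwards [hφ.eventually_lt_const hr, hφ.eventually_lt_const one_pos] with i hir hi
  refine (eLpNorm_sub_le_of_dist_bdd volume hp' hKc.measurableSet hδ.le (fun x => ?_) (hsupp hi)
    ((subset_tsupport u).trans (Metric.self_subset_cthickening _))).trans hδε
  exact (φ i).dist_normed_convolution_le hc.aestronglyMeasurable fun y hy =>
    (hru ((Metric.mem_ball.1 hy).trans hir)).le

lemma tendsto_eLpNorm_mollify_sub (hφ : Tendsto (fun i => (φ i).rOut) l (𝓝 0))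
    (hp : 1 ≤ p) (hp' : p ≠ ⊤) (hu : MemLp u p) :
    Tendsto (fun i => eLpNorm (mollify (φ i) u - u) p volume) l (𝓝 0) := by
  rw [ENNReal.tendsto_nhds_zero]
  intro ε hε
  have hε3 : 0 < ε / 3 := ENNReal.div_pos hε.ne' (by simp)
  obtain ⟨h, hs, huh, hc, hh⟩ := hu.exists_hasCompactSupport_eLpNorm_sub_le hp' hε3.ne'
  filter_upwards [ENNReal.tendsto_nhds_zero.1
    (tendsto_eLpNorm_mollify_sub_of_continuous hφ hp' hc hs) _ hε3] with i hi
  have hsplit : mollify (φ i) u - u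
      = mollify (φ i) (u - h) + ((mollify (φ i) h - h) - (u - h)) := by
    rw [mollify_sub (hu.locallyIntegrable hp) (hh.locallyIntegrable hp)]
    abel
  have m₁ := (memLp_mollify (φ := φ i) hp hp' (hu.sub hh)).1
  have m₂ := ((memLp_mollify (φ := φ i) hp hp' hh).sub hh).1
  have m₃ := (hu.sub hh).1
  calc eLpNorm (mollify (φ i) u - u) p volume
      ≤ eLpNorm (mollify (φ i) (u - h)) p volume
        + (eLpNorm (mollify (φ i) h - h) p volume + eLpNorm (u - h) p volume) := by
        rw [hsplit]
        grw [eLpNorm_add_le m₁ (m₂.sub m₃) hp, eLpNorm_sub_le m₂ m₃ hp]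
    _ ≤ ε / 3 + (ε / 3 + ε / 3) := by grw [eLpNorm_mollify_le hp hp' m₃, hi, huh]
    _ = ε := by rw [← add_assoc, ENNReal.add_thirds]

lemma tendsto_eLpNorm_mollify_sub_restrict (hφ : Tendsto (fun i => (φ i).rOut) l (𝓝 0))
    (hp : 1 ≤ p) (hp' : p ≠ ⊤) {K : Set G} (hK : MeasurableSet K) {δ : ℝ} (hδ : 0 < δ)
    (hu : MemLp u p (volume.restrict (Metric.cthickening δ K))) :
    Tendsto (fun i => eLpNorm (mollify (φ i) u - u) p (volume.restrict K)) l (𝓝 0) := by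
  set v := (Metric.cthickening δ K).indicator u
  have hv : MemLp v p :=
    (memLp_indicator_iff_restrict Metric.isClosed_cthickening.measurableSet).2 hu
  refine tendsto_of_tendsto_of_tendsto_of_le_of_le' tendsto_const_nhds
    (tendsto_eLpNorm_mollify_sub hφ hp hp' hv) (.of_forall fun _ => zero_le) ?_
  filter_upwards [hφ.eventually_lt_const hδ] with i hi
  have heq : Set.EqOn (mollify (φ i) u - u) (mollify (φ i) v - v) K := by
    intro x hx
    have huv : Set.EqOn u v (Metric.ball x (φ i).rOut) := fun y hy =>
      (Set.indicator_of_mem (Metric.mem_cthickening_of_dist_le y x δ K hx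
        ((Metric.mem_ball.1 hy).trans hi).le) u).symm
    rw [Pi.sub_apply, Pi.sub_apply, mollify_eq_of_eqOn_ball huv,
      huv (Metric.mem_ball_self (φ i).rOut_pos)]
  rw [eLpNorm_congr_ae ((ae_restrict_mem hK).mono heq)]
  exact eLpNorm_restrict_le _ _ _ _

end Mollification

section IntegralLimits

variable {X : Type*} [MeasurableSpace X] {μ : Measure X}
  {E : Type*} [NormedAddCommGroup E]

section Inner

variable [InnerProductSpace ℝ E]

lemma integrable_inner {u v : X → E} (hu : MemLp u 2 μ) (hv : MemLp v 2 μ) :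
    Integrable (fun x => ⟪u x, v x⟫) μ :=
  (hu.norm.integrable_mul hv.norm).mono' (hu.1.inner hv.1)
    (ae_of_all _ fun _ => norm_inner_le_norm _ _)

lemma tendsto_integral_inner {u v : X → E} {w : ℕ → X → E} (hu : MemLp u 2 μ) (hv : MemLp v 2 μ)
    (hw : ∀ n, MemLp (w n) 2 μ) (hwv : Tendsto (fun n => eLpNorm (w n - v) 2 μ) atTop (𝓝 0)) :
    Tendsto (fun n => ∫ x, ⟪u x, w n x⟫ ∂μ) atTop (𝓝 (∫ x, ⟪u x, v x⟫ ∂μ)) := by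
  have hlim : Tendsto (fun n => eLpNorm u 2 μ * eLpNorm (w n - v) 2 μ) atTop (𝓝 0) := by
    simpa using ENNReal.Tendsto.const_mul hwv (.inr hu.2.ne)
  refine tendsto_integral_of_L1' _ (integrable_inner hu hv).1
    (.of_forall fun n => integrable_inner hu (hw n))
    (tendsto_of_tendsto_of_tendsto_of_le_of_le tendsto_const_nhds hlim (fun _ => zero_le)
      fun n => ?_)
  have hdiff : (fun x => ⟪u x, w n x⟫) - (fun x => ⟪u x, v x⟫) = fun x => ⟪u x, (w n - v) x⟫ := by
    ext x
    simp [inner_sub_right]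
  rw [hdiff]
  simpa using eLpNorm_le_eLpNorm_mul_eLpNorm'_of_norm (p := 2) (q := 2) (r := 1) hu.1
    ((hw n).sub hv).1 (fun a b => ⟪a, b⟫) 1
    (ae_of_all _ fun x => by
      simpa using norm_inner_le_norm (𝕜 := ℝ) (u x) ((w n - v) x))

end Inner

lemma tendsto_integral_bilin_of_norm_le [NormedSpace ℝ E] {F K : Type*} [NormedAddCommGroup F]
    [NormedSpace ℝ F] [NormedAddCommGroup K] [NormedSpace ℝ K] (L : E →L[ℝ] F →L[ℝ] K)
    {a : X → E} {b : X → F} {s : ℕ → X → E} {t : ℕ → X → F} {C : ℝ}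
    (hs : ∀ n, AEStronglyMeasurable (s n) μ) (hC : ∀ n x, ‖s n x‖ ≤ C)
    (hsa : ∀ᵐ x ∂μ, Tendsto (fun n => s n x) atTop (𝓝 (a x)))
    (hb : Integrable b μ) (ht : ∀ n, Integrable (t n) μ)
    (htb : Tendsto (fun n => eLpNorm (t n - b) 1 μ) atTop (𝓝 0)) :
    Tendsto (fun n => ∫ x, L (s n x) (t n x) ∂μ) atTop (𝓝 (∫ x, L (a x) (b x) ∂μ)) := by
  have hint {c : X → F} (hc : Integrable c μ) (n : ℕ) : Integrable (fun x => L (s n x) (c x)) μ :=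
    L.integrable_of_bilin_of_bdd_left C (hs n) (ae_of_all _ (hC n)) hc
  have hbound (n : ℕ) (x : X) (y : F) : ‖L (s n x) y‖ ≤ ‖L‖ * C * ‖y‖ := by
    grw [L.le_opNorm₂, hC n x]
  have hfixed : Tendsto (fun n => ∫ x, L (s n x) (b x) ∂μ) atTop (𝓝 (∫ x, L (a x) (b x) ∂μ)) := by
    refine tendsto_integral_of_dominated_convergence (fun x => ‖L‖ * C * ‖b x‖)
      (fun n => (hint hb n).1) (hb.norm.const_mul _) (fun n => ae_of_all _ fun x => hbound n x _) ?_
    filter_upwards [hsa] with x hx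
    exact ((L.flip (b x)).continuous.tendsto (a x)).comp hx
  have hdiff : Tendsto (fun n => ∫ x, L (s n x) ((t n - b) x) ∂μ) atTop (𝓝 0) := by
    have hlim :
        Tendsto (fun n => ENNReal.ofReal (‖L‖ * C) * eLpNorm (t n - b) 1 μ) atTop (𝓝 0) := by
      simpa using ENNReal.Tendsto.const_mul htb (.inr ENNReal.ofReal_ne_top)
    rw [← integral_zero X K]
    refine tendsto_integral_of_L1' _ aestronglyMeasurable_zero
      (.of_forall fun n => hint ((ht n).sub hb) n)
      (tendsto_of_tendsto_of_tendsto_of_le_of_le tendsto_const_nhds hlim (fun _ => zero_le)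
        fun n => eLpNorm_le_mul_eLpNorm_of_ae_le_mul (ae_of_all _ fun x => ?_) 1)
    simpa using hbound n x ((t n - b) x)
  refine (zero_add (∫ x, L (a x) (b x) ∂μ) ▸ hdiff.add hfixed).congr fun n => ?_
  rw [← integral_add (hint ((ht n).sub hb) n) (hint hb n)]
  simp only [Pi.sub_apply, map_sub, sub_add_cancel]

lemma integrable_comp_of_lipschitzWith [IsFiniteMeasure μ] {F : Type*} [NormedAddCommGroup F]
    {f : X → E} {ψ : E → F} {M : NNReal} (hψ : LipschitzWith M ψ) (hf : Integrable f μ) :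
    Integrable (ψ ∘ f) μ := by
  refine ((hf.norm.const_mul M).add (integrable_const ‖ψ 0‖)).mono'
    (hψ.continuous.comp_aestronglyMeasurable hf.1) (ae_of_all _ fun x => ?_)
  simpa using (norm_le_norm_sub_add (ψ (f x)) (ψ 0)).trans
    (add_le_add_left (hψ.norm_sub_le (f x) 0) _)

lemma tendsto_eLpNorm_comp_sub_of_lipschitzWith {F : Type*} [NormedAddCommGroup F] {ι : Type*}
    {l : Filter ι} {p : ℝ≥0∞} {u : ι → X → E} {f : X → E} {ψ : E → F} {M : NNReal}
    (hψ : LipschitzWith M ψ) (h : Tendsto (fun n => eLpNorm (u n - f) p μ) l (𝓝 0)) :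
    Tendsto (fun n => eLpNorm (ψ ∘ u n - ψ ∘ f) p μ) l (𝓝 0) := by
  have hM := ENNReal.Tendsto.const_mul (a := ENNReal.ofReal M) h (.inr ENNReal.ofReal_ne_top)
  rw [mul_zero] at hM
  exact tendsto_of_tendsto_of_tendsto_of_le_of_le tendsto_const_nhds hM (fun _ => zero_le)
    fun n => eLpNorm_le_mul_eLpNorm_of_ae_le_mul (ae_of_all _ fun x => hψ.norm_sub_le _ _) p

lemma integrable_of_tendsto_of_integral_norm_le {u : ℕ → X → E} {f : X → E} {K : ℝ}
    (hlim : ∀ᵐ x ∂μ, Tendsto (fun n => u n x) atTop (𝓝 (f x))) (hu : ∀ n, Integrable (u n) μ)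
    (hK : ∀ n, ∫ x, ‖u n x‖ ∂μ ≤ K) : Integrable f μ := by
  refine ⟨aestronglyMeasurable_of_tendsto_ae _ (fun n => (hu n).1) hlim, ?_⟩
  calc ∫⁻ x, ‖f x‖ₑ ∂μ = ∫⁻ x, liminf (fun n => ‖u n x‖ₑ) atTop ∂μ :=
        lintegral_congr_ae (hlim.mono fun x hx => hx.enorm.liminf_eq.symm)
    _ ≤ liminf (fun n => ∫⁻ x, ‖u n x‖ₑ ∂μ) atTop := lintegral_liminf_le' fun n => (hu n).1.enorm
    _ ≤ liminf (fun _ : ℕ => ENNReal.ofReal K) atTop := liminf_le_liminf (.of_forall fun n => by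
        rw [← ofReal_integral_norm_eq_lintegral_enorm (hu n)]
        exact ENNReal.ofReal_le_ofReal (hK n))
    _ < ⊤ := by simp

end IntegralLimits

section CompactSupport

variable {G : Type*} [NormedAddCommGroup G] [MeasurableSpace G] [BorelSpace G] {μ : Measure G}
  {E F K : Type*} [NormedAddCommGroup E] [NormedSpace ℝ E] [NormedAddCommGroup F] [NormedSpace ℝ F]
  [NormedAddCommGroup K] [NormedSpace ℝ K] (L : E →L[ℝ] F →L[ℝ] K)

lemma integrable_bilin_of_tsupport_subset {D : Set G} {u : G → E} {w : G → F}
    (hu : LocallyIntegrableOn u D μ) (hw : Continuous w) (hs : HasCompactSupport w)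
    (hD : tsupport w ⊆ D) : Integrable (fun x => L (u x) (w x)) μ := by
  obtain ⟨C, hC⟩ := hw.bounded_above_of_compact_support hs
  refine (integrableOn_iff_integrable_of_support_subset (s := tsupport w) fun x hx => ?_).1 ?_
  · exact subset_tsupport w fun h : w x = 0 => hx (by simp [h])
  · exact L.integrable_of_bilin_of_bdd_right C (hu.integrableOn_compact_subset hD hs)
      (hw.stronglyMeasurable_of_hasCompactSupport hs).aestronglyMeasurable (ae_of_all _ hC)

lemma integral_bilin_fderiv_eq_neg [NormedSpace ℝ G] [FiniteDimensional ℝ G] [μ.IsAddHaarMeasure]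
    {u : G → E} {w : G → F} (hu : ContDiff ℝ 1 u) (hw : ContDiff ℝ 1 w) (hs : HasCompactSupport w)
    (v : G) : ∫ x, L (u x) (fderiv ℝ w x v) ∂μ = -∫ x, L (fderiv ℝ u x v) (w x) ∂μ := by
  have hint {u : G → E} {w : G → F} (hu : Continuous u) (hw : Continuous w)
      (hs : HasCompactSupport w) : Integrable (fun x => L (u x) (w x)) μ :=
    integrable_bilin_of_tsupport_subset L (hu.locallyIntegrable.locallyIntegrableOn _) hw hs
      (Set.subset_univ _)
  have hu' := (hu.continuous_fderiv one_ne_zero).clm_apply (continuous_const (y := v))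
  have hw' := (hw.continuous_fderiv one_ne_zero).clm_apply (continuous_const (y := v))
  exact integral_bilinear_fderiv_right_eq_neg_left_of_integrable (hint hu' hw.continuous hs)
    (hint hu.continuous hw' (hs.fderiv_apply ℝ v)) (hint hu.continuous hw.continuous hs)
    (fun x _ => hu.differentiable one_ne_zero x) (fun x _ => hw.differentiable one_ne_zero x)

end CompactSupport

/-! ### Weak gradients -/

section Gradient

variable {E : Type*} [NormedAddCommGroup E] [InnerProductSpace ℝ E] [CompleteSpace E] {u : E → ℝ}

lemma continuous_gradient (hu : ContDiff ℝ 1 u) : Continuous (gradient u) :=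
  (InnerProductSpace.toDual ℝ E).symm.continuous.comp (hu.continuous_fderiv one_ne_zero)

lemma tsupport_gradient_subset : tsupport (gradient u) ⊆ tsupport u := by
  refine (closure_mono fun x hx => ?_).trans (tsupport_fderiv_subset ℝ)
  exact fun h => hx (by simp [gradient, h])

lemma hasCompactSupport_gradient (hs : HasCompactSupport u) : HasCompactSupport (gradient u) :=
  hs.of_isClosed_subset (isClosed_tsupport _) tsupport_gradient_subset

lemma gradient_comp {ψ : ℝ → ℝ} (hψ : Differentiable ℝ ψ) (hu : Differentiable ℝ u) (x : E) :
    gradient (ψ ∘ u) x = deriv ψ (u x) • gradient u x := by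
  refine ext_inner_right ℝ fun e => ?_
  rw [real_inner_smul_left, inner_gradient_left, inner_gradient_left,
    ((hψ (u x)).hasDerivAt.comp_hasFDerivAt x (hu x).hasFDerivAt).fderiv]
  rfl

end Gradient

lemma IsTestFunction.contDiff_one {F : Type*} [NormedAddCommGroup F] [NormedSpace ℝ F] {D : Set E3}
    {φ : E3 → F} (hφ : IsTestFunction D φ) : ContDiff ℝ 1 φ :=
  hφ.1.of_le (by simp)

lemma isTestFunction_mollifier_sub {D : Set E3} {η : ContDiffBump (0 : E3)} {x : E3}
    (hx : Metric.closedBall x η.rOut ⊆ D) :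
    IsTestFunction D fun y => η.normed volume (x - y) := by
  refine ⟨η.contDiff_normed.comp (contDiff_const.sub contDiff_id),
    η.hasCompactSupport_normed.comp_homeomorph (Homeomorph.subLeft x),
    (closure_minimal (fun y hy => ?_) Metric.isClosed_closedBall).trans hx⟩
  have hxy : x - y ∈ Function.support (η.normed volume) := hy
  rw [η.support_normed_eq, mem_ball_zero_iff, ← dist_eq_norm'] at hxy
  exact hxy.le

lemma gradient_apply (u : E3 → ℝ) (x : E3) (i : Fin 3) :
    gradient u x i = fderiv ℝ u x (EuclideanSpace.single i 1) := by
  rw [← inner_gradient_left, EuclideanSpace.inner_single_right]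
  simp

section WeakGradient

variable {D : Set E3} {f f' : E3 → ℝ} {G G' : E3 → E3} {φ : E3 → ℝ}

lemma integrable_smul_gradient (hf : LocallyIntegrableOn f D) (hφ : IsTestFunction D φ) :
    Integrable fun x => f x • gradient φ x :=
  integrable_bilin_of_tsupport_subset (lsmul ℝ ℝ) hf (continuous_gradient hφ.contDiff_one)
    (hasCompactSupport_gradient hφ.2.1) (tsupport_gradient_subset.trans hφ.2.2)

lemma integrable_smul_of_isTestFunction (hG : LocallyIntegrableOn G D) (hφ : IsTestFunction D φ) :
    Integrable fun x => φ x • G x :=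
  integrable_bilin_of_tsupport_subset (lsmul ℝ ℝ).flip hG hφ.1.continuous hφ.2.1 hφ.2.2

lemma isWeakGrad_iff : IsWeakGrad D f G ↔ LocallyIntegrableOn f D ∧ LocallyIntegrableOn G D ∧
    ∀ φ : E3 → ℝ, IsTestFunction D φ → ∫ x, f x • gradient φ x = -∫ x, φ x • G x := by
  have hcomponents (hf : LocallyIntegrableOn f D) (hG : LocallyIntegrableOn G D) {φ : E3 → ℝ}
      (hφ : IsTestFunction D φ) : ∫ x, f x • gradient φ x = -∫ x, φ x • G x ↔
      ∀ i, ∫ x in D, f x * fderiv ℝ φ x (EuclideanSpace.single i 1) = -∫ x in D, G x i * φ x := by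
    rw [PiLp.ext_iff]
    refine forall_congr' fun i => ?_
    rw [PiLp.neg_apply,
      eval_integral_piLp fun i => (EuclideanSpace.proj (𝕜 := ℝ) i).integrable_comp
        (integrable_smul_gradient hf hφ),
      eval_integral_piLp fun i => (EuclideanSpace.proj (𝕜 := ℝ) i).integrable_comp
        (integrable_smul_of_isTestFunction hG hφ),
      setIntegral_eq_integral_of_forall_compl_eq_zero fun x hx => ?_,
      setIntegral_eq_integral_of_forall_compl_eq_zero fun x hx => ?_]
    · simp only [PiLp.smul_apply, smul_eq_mul, gradient_apply, mul_comm (φ _)]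
    · rw [image_eq_zero_of_notMem_tsupport fun h => hx (hφ.2.2 h), mul_zero]
    · rw [image_eq_zero_of_notMem_tsupport fun h => hx (hφ.2.2 (tsupport_fderiv_subset ℝ h)),
        zero_apply, mul_zero]
  exact ⟨fun h => ⟨h.locInt, h.locInt_grad, fun φ hφ =>
      (hcomponents h.locInt h.locInt_grad hφ).2 (h.integral_eq φ hφ)⟩,
    fun ⟨hf, hG, h⟩ => ⟨hf, hG, fun φ hφ => (hcomponents hf hG hφ).1 (h φ hφ)⟩⟩

lemma IsWeakGrad.integral_smul_gradient (h : IsWeakGrad D f G) (hφ : IsTestFunction D φ) :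
    ∫ x, f x • gradient φ x = -∫ x, φ x • G x :=
  (isWeakGrad_iff.1 h).2.2 φ hφ

lemma IsWeakGrad.ae_eq (hD : IsOpen D) (h : IsWeakGrad D f G) (h' : IsWeakGrad D f G') :
    G =ᵐ[volume.restrict D] G' := by
  have hzero := hD.ae_eq_zero_of_integral_contDiff_smul_eq_zero (h.locInt_grad.sub h'.locInt_grad)
    fun φ hc hs hφD => by
      have hφ : IsTestFunction D φ := ⟨hc, hs, hφD⟩
      simp only [Pi.sub_apply, smul_sub]
      rw [integral_sub (integrable_smul_of_isTestFunction h.locInt_grad hφ)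
        (integrable_smul_of_isTestFunction h'.locInt_grad hφ), sub_eq_zero, ← neg_inj,
        ← h.integral_smul_gradient hφ, h'.integral_smul_gradient hφ]
  filter_upwards [(ae_restrict_iff' hD.measurableSet).2 hzero] with x hx using sub_eq_zero.1 hx

lemma isWeakGrad_weakGrad (h : ∃ G, IsWeakGrad D f G) : IsWeakGrad D f (weakGrad D f) := by
  rw [weakGrad, dif_pos h]
  exact h.choose_spec

lemma IsWeakGrad.weakGrad_ae_eq (hD : IsOpen D) (h : IsWeakGrad D f G) :
    weakGrad D f =ᵐ[volume.restrict D] G :=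
  (isWeakGrad_weakGrad ⟨G, h⟩).ae_eq hD h

lemma IsWeakGrad.memH1 (hD : IsOpen D) (h : IsWeakGrad D f G) (hf : MemLp f 2 (volume.restrict D))
    (hG : MemLp G 2 (volume.restrict D)) : MemH1 D f :=
  ⟨hf, ⟨G, h⟩, hG.ae_eq (h.weakGrad_ae_eq hD).symm⟩

lemma IsWeakGrad.sub (h : IsWeakGrad D f G) (h' : IsWeakGrad D f' G') :
    IsWeakGrad D (f - f') (G - G') := by
  refine isWeakGrad_iff.2 ⟨h.locInt.sub h'.locInt, h.locInt_grad.sub h'.locInt_grad,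
    fun φ hφ => ?_⟩
  simp only [Pi.sub_apply, sub_smul, smul_sub]
  rw [integral_sub (integrable_smul_gradient h.locInt hφ) (integrable_smul_gradient h'.locInt hφ),
    integral_sub (integrable_smul_of_isTestFunction h.locInt_grad hφ)
      (integrable_smul_of_isTestFunction h'.locInt_grad hφ),
    h.integral_smul_gradient hφ, h'.integral_smul_gradient hφ]
  abel

lemma isWeakGrad_gradient {u : E3 → ℝ} (hu : ContDiff ℝ 1 u) :
    IsWeakGrad Set.univ u (gradient u) := by
  refine ⟨hu.continuous.locallyIntegrable.locallyIntegrableOn _,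
    (continuous_gradient hu).locallyIntegrable.locallyIntegrableOn _, fun φ hφ i => ?_⟩
  simp only [setIntegral_univ, gradient_apply]
  exact integral_bilin_fderiv_eq_neg (ContinuousLinearMap.mul ℝ ℝ) hu hφ.contDiff_one hφ.2.1 _

lemma memH1_univ_of_contDiff {u : E3 → ℝ} (hu : ContDiff ℝ 1 u) (hs : HasCompactSupport u) :
    MemH1 Set.univ u :=
  (isWeakGrad_gradient hu).memH1 isOpen_univ
    ((hu.continuous.memLp_of_hasCompactSupport hs).restrict _)
    (((continuous_gradient hu).memLp_of_hasCompactSupport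
      (hasCompactSupport_gradient hs)).restrict _)

lemma IsWeakGrad.gradient_mollify {η : ContDiffBump (0 : E3)} {v : E3 → ℝ} {w : E3 → E3} {x : E3}
    (h : IsWeakGrad D f G) (hv : LocallyIntegrable v) (hx : Metric.closedBall x η.rOut ⊆ D)
    (hvf : Set.EqOn v f (Metric.closedBall x η.rOut))
    (hwG : Set.EqOn w G (Metric.closedBall x η.rOut)) :
    gradient (mollify η v) x = mollify η w x := by
  set k : E3 → ℝ := fun y => η.normed volume (x - y)
  have hkD : IsTestFunction D k := isTestFunction_mollifier_sub hx
  have hsupp : tsupport k ⊆ Metric.closedBall x η.rOut :=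
    (isTestFunction_mollifier_sub subset_rfl).2.2
  have hv' : ∫ y, v y • gradient k y = ∫ y, f y • gradient k y := by
    congr! 2 with y
    by_cases hy : y ∈ Metric.closedBall x η.rOut
    · rw [hvf hy]
    · simp [image_eq_zero_of_notMem_tsupport fun h => hy (hsupp (tsupport_gradient_subset h))]
  have hw' : ∫ y, k y • w y = ∫ y, k y • G y := by
    congr! 2 with y
    by_cases hy : y ∈ Metric.closedBall x η.rOut
    · rw [hwG hy]
    · simp [image_eq_zero_of_notMem_tsupport fun h => hy (hsupp h)]
  refine ext_inner_left ℝ fun e => ?_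
  calc ⟪e, gradient (mollify η v) x⟫
      = ContinuousLinearMap.apply ℝ ℝ e (fderiv ℝ (mollify η v) x) := by
        simp [inner_gradient_right]
    _ = -∫ y, ⟪e, v y • gradient k y⟫ := by
        rw [fderiv_mollify _ hv]
        simp [inner_smul_right, inner_gradient_right, mul_comm, k]
    _ = ⟪e, -∫ y, v y • gradient k y⟫ := by
        rw [integral_inner (integrable_smul_gradient (hv.locallyIntegrableOn D) hkD),
          inner_neg_right]
    _ = ⟪e, mollify η w x⟫ := by
        rw [hv', h.integral_smul_gradient hkD, neg_neg, ← hw', mollify_apply_swap]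

lemma IsWeakGrad.exists_contDiff_tendsto {K : Set E3} (h : IsWeakGrad D f G) (hD : IsOpen D)
    (hK : IsCompact K) (hKD : K ⊆ D) :
    ∃ u : ℕ → E3 → ℝ, (∀ n, ContDiff ℝ 1 (u n)) ∧
      (∀ᵐ x ∂volume.restrict K, Tendsto (fun n => u n x) atTop (𝓝 (f x))) ∧
      Tendsto (fun n => eLpNorm (u n - f) 1 (volume.restrict K)) atTop (𝓝 0) ∧
      Tendsto (fun n => eLpNorm (gradient (u n) - G) 1 (volume.restrict K)) atTop (𝓝 0) := by
  obtain ⟨δ, hδ, hδD⟩ := hK.exists_cthickening_subset_open hD hKD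
  set T : Set E3 := Metric.cthickening δ K
  have hT : IsCompact T := hK.cthickening
  have hindicator {E : Type} [NormedAddCommGroup E] {v : E3 → E} (hv : LocallyIntegrableOn v D) :
      MemLp (T.indicator v) 1 :=
    memLp_one_iff_integrable.2 ((integrable_indicator_iff hT.measurableSet).2
      (hv.integrableOn_compact_subset hδD hT))
  have hf := hindicator h.locInt
  have hG := hindicator h.locInt_grad
  obtain ⟨φ, hφ, hφ2⟩ := exists_bump_tendsto_zero E3
  have hKT : ∀ᵐ x ∂volume.restrict K, x ∈ T :=
    (ae_restrict_mem hK.measurableSet).mono (Metric.self_subset_cthickening K)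
  refine ⟨fun n => mollify (φ n) (T.indicator f), fun n => ?_, ?_, ?_, ?_⟩
  · exact (contDiff_mollify (hf.locallyIntegrable le_rfl)).of_le (by simp)
  · filter_upwards [hKT, ae_restrict_of_ae
      (ContDiffBump.ae_convolution_tendsto_right_of_locallyIntegrable hφ (.of_forall hφ2)
        (hf.locallyIntegrable le_rfl))] with x hx hlim
    rwa [Set.indicator_of_mem hx] at hlim
  · refine tendsto_of_tendsto_of_tendsto_of_le_of_le tendsto_const_nhds
      (tendsto_eLpNorm_mollify_sub hφ le_rfl ENNReal.one_ne_top hf) (fun _ => zero_le) fun n => ?_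
    refine (eLpNorm_congr_ae ?_).trans_le (eLpNorm_restrict_le _ _ _ K)
    filter_upwards [hKT] with x hx
    simp [hx]
  · refine tendsto_of_tendsto_of_tendsto_of_le_of_le' tendsto_const_nhds
      (tendsto_eLpNorm_mollify_sub hφ le_rfl ENNReal.one_ne_top hG) (.of_forall fun _ => zero_le) ?_
    filter_upwards [hφ.eventually_lt_const hδ] with n hn
    refine (eLpNorm_congr_ae ?_).trans_le (eLpNorm_restrict_le _ _ _ K)
    filter_upwards [hKT, ae_restrict_mem hK.measurableSet] with x hxT hxK
    have hball : Metric.closedBall x (φ n).rOut ⊆ T :=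
      (Metric.closedBall_subset_cthickening hxK _).trans (Metric.cthickening_mono hn.le K)
    simp only [Pi.sub_apply, Set.indicator_of_mem hxT]
    rw [h.gradient_mollify (hf.locallyIntegrable le_rfl) (hball.trans hδD)
      (Set.eqOn_indicator.mono hball) (Set.eqOn_indicator.mono hball)]

lemma integral_comp_smul_gradient {u : E3 → ℝ} (hu : ContDiff ℝ 1 u) {ψ : ℝ → ℝ}
    (hψ : ContDiff ℝ 1 ψ) (hφ : IsTestFunction D φ) :
    ∫ x in tsupport φ, ψ (u x) • gradient φ x
      = -∫ x in tsupport φ, (φ x * deriv ψ (u x)) • gradient u x := by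
  have h := (isWeakGrad_gradient (hψ.comp hu)).integral_smul_gradient
    ⟨hφ.1, hφ.2.1, Set.subset_univ _⟩
  rw [setIntegral_eq_integral_of_forall_compl_eq_zero fun x hx => ?_,
    setIntegral_eq_integral_of_forall_compl_eq_zero fun x hx => ?_]
  · simpa only [Function.comp_apply, smul_smul, gradient_comp (hψ.differentiable one_ne_zero)
      (hu.differentiable one_ne_zero)] using h
  · simp [image_eq_zero_of_notMem_tsupport hx]
  · simp [image_eq_zero_of_notMem_tsupport fun h => hx (tsupport_gradient_subset h)]

lemma IsWeakGrad.integral_comp_smul_gradient (h : IsWeakGrad D f G) (hD : IsOpen D) {ψ : ℝ → ℝ}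
    (hψ : ContDiff ℝ 1 ψ) {M : NNReal} (hM : ∀ s, ‖deriv ψ s‖₊ ≤ M) (hφ : IsTestFunction D φ) :
    ∫ x in tsupport φ, ψ (f x) • gradient φ x
      = -∫ x in tsupport φ, (φ x * deriv ψ (f x)) • G x := by
  have hLip : LipschitzWith M ψ :=
    lipschitzWith_of_nnnorm_deriv_le (hψ.differentiable one_ne_zero) hM
  have hψ' : Continuous (deriv ψ) := hψ.continuous_deriv le_rfl
  have hK : IsCompact (tsupport φ) := hφ.2.1
  have : IsFiniteMeasure (volume.restrict (tsupport φ)) :=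
    isFiniteMeasure_restrict.2 hK.measure_ne_top
  obtain ⟨C, hC⟩ := hφ.1.continuous.bounded_above_of_compact_support hφ.2.1
  obtain ⟨C', hC'⟩ := (continuous_gradient hφ.contDiff_one).bounded_above_of_compact_support
    (hasCompactSupport_gradient hφ.2.1)
  obtain ⟨u, hu, hae, hlim, hlimG⟩ := h.exists_contDiff_tendsto hD hK hφ.2.2
  have hf := h.locInt.integrableOn_compact_subset hφ.2.2 hK
  have hG := h.locInt_grad.integrableOn_compact_subset hφ.2.2 hK
  have hleft := tendsto_integral_bilin_of_norm_le (lsmul ℝ ℝ : ℝ →L[ℝ] E3 →L[ℝ] E3).flip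
    (s := fun _ => gradient φ)
    (fun _ => (continuous_gradient hφ.contDiff_one).aestronglyMeasurable) (fun _ => hC')
    (ae_of_all _ fun _ => tendsto_const_nhds) (integrable_comp_of_lipschitzWith hLip hf)
    (fun n => ((hψ.continuous.comp (hu n).continuous).continuousOn.integrableOn_compact hK))
    (tendsto_eLpNorm_comp_sub_of_lipschitzWith hLip hlim)
  have hright := tendsto_integral_bilin_of_norm_le (lsmul ℝ ℝ : ℝ →L[ℝ] E3 →L[ℝ] E3)
    (s := fun n x => φ x * deriv ψ (u n x)) (C := C * M)
    (fun n => (hφ.1.continuous.mul (hψ'.comp (hu n).continuous)).aestronglyMeasurable)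
    (fun n x => (norm_mul _ _).trans_le
      (mul_le_mul (hC x) (hM _) (norm_nonneg _) ((norm_nonneg _).trans (hC x))))
    (hae.mono fun x hx => ((hψ'.tendsto _).comp hx).const_mul (φ x)) hG
    (fun n => (continuous_gradient (hu n)).continuousOn.integrableOn_compact hK) hlimG
  exact tendsto_nhds_unique hleft (hright.neg.congr fun n =>
    (Meissner.integral_comp_smul_gradient (hu n) hψ hφ).symm)

lemma IsWeakGrad.comp (h : IsWeakGrad D f G) (hD : IsOpen D) {ψ : ℝ → ℝ} (hψ : ContDiff ℝ 1 ψ)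
    {M : NNReal} (hM : ∀ s, ‖deriv ψ s‖₊ ≤ M) :
    IsWeakGrad D (ψ ∘ f) (fun x => deriv ψ (f x) • G x) := by
  have hLip : LipschitzWith M ψ :=
    lipschitzWith_of_nnnorm_deriv_le (hψ.differentiable one_ne_zero) hM
  refine isWeakGrad_iff.2 ⟨(locallyIntegrableOn_iff hD.isLocallyClosed).2 fun K hKD hK => ?_,
    (locallyIntegrableOn_iff hD.isLocallyClosed).2 fun K hKD hK => ?_, fun φ hφ => ?_⟩
  · have : IsFiniteMeasure (volume.restrict K) := isFiniteMeasure_restrict.2 hK.measure_ne_top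
    exact integrable_comp_of_lipschitzWith hLip (h.locInt.integrableOn_compact_subset hKD hK)
  · exact (h.locInt_grad.integrableOn_compact_subset hKD hK).bdd_smul M
      ((hψ.continuous_deriv le_rfl).comp_aestronglyMeasurable
        (h.locInt.integrableOn_compact_subset hKD hK).1) (ae_of_all _ fun x => hM (f x))
  · have key := h.integral_comp_smul_gradient hD hψ hM hφ
    rw [setIntegral_eq_integral_of_forall_compl_eq_zero fun x hx => ?_,
      setIntegral_eq_integral_of_forall_compl_eq_zero fun x hx => ?_] at key
    · simpa only [Function.comp_apply, smul_smul] using key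
    · simp [image_eq_zero_of_notMem_tsupport hx]
    · simp [image_eq_zero_of_notMem_tsupport fun h => hx (tsupport_gradient_subset h)]

lemma MemH1.isWeakGrad (h : MemH1 D f) : IsWeakGrad D f (weakGrad D f) :=
  isWeakGrad_weakGrad h.exists_weakGrad

lemma MemH1.sub (hD : IsOpen D) (h : MemH1 D f) (h' : MemH1 D f') : MemH1 D (f - f') :=
  (h.isWeakGrad.sub h'.isWeakGrad).memH1 hD (h.memLp.sub h'.memLp)
    (h.memLp_weakGrad.sub h'.memLp_weakGrad)

lemma MemH1.comp (h : MemH1 D f) (hD : IsOpen D) {ψ : ℝ → ℝ} (hψ : ContDiff ℝ 1 ψ) (hψ0 : ψ 0 = 0)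
    {M : NNReal} (hM : ∀ s, ‖deriv ψ s‖₊ ≤ M) : MemH1 D (ψ ∘ f) :=
  (h.isWeakGrad.comp hD hψ hM).memH1 hD
    ((lipschitzWith_of_nnnorm_deriv_le (hψ.differentiable one_ne_zero) hM).comp_memLp hψ0 h.memLp)
    (h.memLp_weakGrad.of_le_mul (c := M)
      (((hψ.continuous_deriv le_rfl).comp_aestronglyMeasurable h.memLp.1).smul h.memLp_weakGrad.1)
      (ae_of_all _ fun _ => (norm_smul_le _ _).trans
        (mul_le_mul_of_nonneg_right (hM _) (norm_nonneg _))))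

end WeakGradient

/-! ### Weak curls -/

/-- The curl of a vector field as a linear function of its derivative. -/
def curlMap : (E3 →L[ℝ] E3) →L[ℝ] E3 :=
  LinearMap.toContinuousLinearMap
    { toFun T := !₂[T (EuclideanSpace.single 1 1) 2 - T (EuclideanSpace.single 2 1) 1,
        T (EuclideanSpace.single 2 1) 0 - T (EuclideanSpace.single 0 1) 2,
        T (EuclideanSpace.single 0 1) 1 - T (EuclideanSpace.single 1 1) 0]
      map_add' S T := by
        ext i
        fin_cases i <;> simp <;> ring
      map_smul' c T := by
        ext i
        fin_cases i <;> simp <;> ring }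

lemma curl_apply (W : E3 → E3) (x : E3) : curl W x = curlMap (fderiv ℝ W x) := rfl

lemma inner_curlMap_smulRight (ℓ : E3 →L[ℝ] ℝ) (a e : E3) :
    ⟪curlMap (ℓ.smulRight a), e⟫ = -⟪a, curlMap (ℓ.smulRight e)⟫ := by
  simp [curlMap, PiLp.inner_apply, Fin.sum_univ_three]
  ring

lemma curl_eq_sum (W : E3 → E3) (x : E3) :
    curl W x = ∑ j, curlMap ((EuclideanSpace.proj (𝕜 := ℝ) j).smulRight
      (fderiv ℝ W x (EuclideanSpace.single j 1))) := by
  rw [curl_apply, ← map_sum]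
  congr 1
  ext y : 1
  nth_rw 1 [← (EuclideanSpace.basisFun (Fin 3) ℝ).sum_repr y]
  simp

section Curl

variable {W φ : E3 → E3}

lemma continuous_curl (hW : ContDiff ℝ 1 W) : Continuous (curl W) :=
  curlMap.continuous.comp (hW.continuous_fderiv one_ne_zero)

lemma tsupport_curl_subset : tsupport (curl W) ⊆ tsupport W :=
  (tsupport_comp_subset curlMap.map_zero _).trans (tsupport_fderiv_subset ℝ)

lemma hasCompactSupport_curl (hs : HasCompactSupport W) : HasCompactSupport (curl W) :=
  hs.mono' ((subset_tsupport _).trans tsupport_curl_subset)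

lemma curl_smul_const {g : E3 → ℝ} (hg : Differentiable ℝ g) (e x : E3) :
    curl (fun y => g y • e) x = curlMap ((fderiv ℝ g x).smulRight e) := by
  rw [curl_apply, fderiv_smul_const (hg x)]

lemma integral_inner_curl_eq (hW : ContDiff ℝ 1 W) (hφ : ContDiff ℝ 1 φ)
    (hs : HasCompactSupport φ) : ∫ x, ⟪W x, curl φ x⟫ = ∫ x, ⟪curl W x, φ x⟫ := by
  let e (j : Fin 3) : E3 := EuclideanSpace.single j 1
  let B (j : Fin 3) : E3 →L[ℝ] E3 →L[ℝ] ℝ := (innerSL ℝ).bilinearComp (.id ℝ E3)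
    (curlMap ∘L smulRightL ℝ E3 E3 (EuclideanSpace.proj (𝕜 := ℝ) j))
  have hint {u w : E3 → E3} (hu : Continuous u) (hw : Continuous w) (hs : HasCompactSupport w)
      (j : Fin 3) : Integrable fun x => B j (u x) (w x) :=
    integrable_bilin_of_tsupport_subset _ (hu.locallyIntegrable.locallyIntegrableOn _) hw hs
      (Set.subset_univ _)
  have hright (x : E3) : ⟪W x, curl φ x⟫ = ∑ j, B j (W x) (fderiv ℝ φ x (e j)) := by
    rw [curl_eq_sum, inner_sum]
    rfl
  have hleft (x : E3) : ⟪curl W x, φ x⟫ = -∑ j, B j (fderiv ℝ W x (e j)) (φ x) := by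
    simp only [curl_eq_sum, sum_inner, inner_curlMap_smulRight, Finset.sum_neg_distrib]
    rfl
  simp only [hright, hleft]
  rw [integral_neg, integral_finsetSum _ fun j _ => ?_, integral_finsetSum _ fun j _ => ?_,
    ← Finset.sum_neg_distrib]
  · exact Finset.sum_congr rfl fun j _ => integral_bilin_fderiv_eq_neg (B j) hW hφ hs _
  · exact hint ((hW.continuous_fderiv one_ne_zero).clm_apply continuous_const) hφ.continuous hs j
  · exact hint hW.continuous ((hφ.continuous_fderiv one_ne_zero).clm_apply continuous_const)
      (hs.fderiv_apply ℝ _) j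

lemma isWeakCurl_curl (hW : ContDiff ℝ 1 W) : IsWeakCurl W (curl W) :=
  ⟨hW.continuous.locallyIntegrable, (continuous_curl hW).locallyIntegrable,
    fun _ hφ => integral_inner_curl_eq hW hφ.contDiff_one hφ.2.1⟩

end Curl

section WeakCurl

variable {A A' C C' : E3 → E3}

lemma isTestFunction_smul_const {D : Set E3} {g : E3 → ℝ} (hg : IsTestFunction D g) (e : E3) :
    IsTestFunction D fun x => g x • e :=
  ⟨hg.1.smul contDiff_const, hg.2.1.smul_right,
    (closure_mono (Function.support_smul_subset_left _ _)).trans hg.2.2⟩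

lemma integrable_inner_of_hasCompactSupport {w : E3 → E3} (hA : LocallyIntegrable A)
    (hw : Continuous w) (hs : HasCompactSupport w) : Integrable fun x => ⟪A x, w x⟫ :=
  integrable_bilin_of_tsupport_subset (innerSL ℝ) (hA.locallyIntegrableOn _) hw hs
    (Set.subset_univ _)

lemma IsWeakCurl.integral_inner_smul (h : IsWeakCurl A C) {g : E3 → ℝ}
    (hg : IsTestFunction Set.univ g) (e : E3) :
    ⟪e, ∫ x, g x • C x⟫ = ∫ x, ⟪A x, curlMap ((fderiv ℝ g x).smulRight e)⟫ := by
  rw [← integral_inner (integrable_smul_of_isTestFunction (h.locInt_curl.locallyIntegrableOn _) hg)]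
  simp only [← curl_smul_const (hg.contDiff_one.differentiable one_ne_zero),
    h.integral_eq _ (isTestFunction_smul_const hg e), inner_smul_right, real_inner_comm e]

lemma IsWeakCurl.ae_eq (h : IsWeakCurl A C) (h' : IsWeakCurl A C') : C =ᵐ[volume] C' :=
  ae_eq_of_integral_contDiff_smul_eq h.locInt_curl h'.locInt_curl fun _ hg hs =>
    ext_inner_left ℝ fun e => by
      rw [h.integral_inner_smul ⟨hg, hs, Set.subset_univ _⟩,
        h'.integral_inner_smul ⟨hg, hs, Set.subset_univ _⟩]

lemma isWeakCurl_weakCurl (h : ∃ C, IsWeakCurl A C) : IsWeakCurl A (weakCurl A) := by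
  rw [weakCurl, dif_pos h]
  exact h.choose_spec

lemma IsWeakCurl.weakCurl_ae_eq (h : IsWeakCurl A C) : weakCurl A =ᵐ[volume] C :=
  (isWeakCurl_weakCurl ⟨C, h⟩).ae_eq h

lemma IsWeakCurl.sub (h : IsWeakCurl A C) (h' : IsWeakCurl A' C') :
    IsWeakCurl (A - A') (C - C') := by
  refine ⟨h.locInt.sub h'.locInt, h.locInt_curl.sub h'.locInt_curl, fun φ hφ => ?_⟩
  have hcurl := continuous_curl hφ.contDiff_one
  have hcurls := hasCompactSupport_curl hφ.2.1
  simp only [Pi.sub_apply, inner_sub_left]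
  rw [integral_sub (integrable_inner_of_hasCompactSupport h.locInt hcurl hcurls)
      (integrable_inner_of_hasCompactSupport h'.locInt hcurl hcurls),
    integral_sub (integrable_inner_of_hasCompactSupport h.locInt_curl hφ.1.continuous hφ.2.1)
      (integrable_inner_of_hasCompactSupport h'.locInt_curl hφ.1.continuous hφ.2.1),
    h.integral_eq φ hφ, h'.integral_eq φ hφ]

lemma IsWeakCurl.curl_mollify (h : IsWeakCurl A C) (η : ContDiffBump (0 : E3)) :
    curl (mollify η A) = mollify η C := by
  ext1 x
  refine ext_inner_left ℝ fun e => ?_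
  have hη : IsTestFunction Set.univ fun y => η.normed volume (x - y) :=
    isTestFunction_mollifier_sub (Set.subset_univ _)
  calc ⟪e, curl (mollify η A) x⟫ = (innerSL ℝ e ∘L curlMap) (fderiv ℝ (mollify η A) x) := rfl
    _ = ∫ y, ⟪A y, curlMap ((fderiv ℝ (fun y => η.normed volume (x - y)) y).smulRight e)⟫ := by
        rw [fderiv_mollify _ h.locInt, ← integral_neg]
        congr! 2 with y
        rw [comp_apply, innerSL_apply_apply, real_inner_comm, inner_curlMap_smulRight, neg_neg]
    _ = ⟪e, mollify η C x⟫ := by rw [mollify_apply_swap, h.integral_inner_smul hη]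

end WeakCurl

/-! ### Smooth test fields -/

section SmoothTestFields

variable {Ω : Set E3} {U W φ : E3 → E3}

lemma outerTangentialTrace_of_contDiff (hW : ContDiff ℝ 1 W) (hφ : IsTestFunction Set.univ φ) :
    outerTangentialTrace Ω W φ = -∫ x in closure Ω, (⟪curl W x, φ x⟫ - ⟪W x, curl φ x⟫) := by
  have hleft := integrable_inner_of_hasCompactSupport (continuous_curl hW).locallyIntegrable
    hφ.1.continuous hφ.2.1
  have hright := integrable_inner_of_hasCompactSupport hW.continuous.locallyIntegrable
    (continuous_curl hφ.contDiff_one) (hasCompactSupport_curl hφ.2.1)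
  have hsplit := integral_add_compl (s := closure Ω) isClosed_closure.measurableSet
    (hleft.sub hright)
  rw [integral_sub' hleft hright, integral_inner_curl_eq hW hφ.contDiff_one hφ.2.1,
    sub_self] at hsplit
  refine (integral_congr_ae (ae_restrict_of_ae ?_)).trans (eq_neg_of_add_eq_zero_right hsplit)
  filter_upwards [(isWeakCurl_curl hW).weakCurl_ae_eq] with x hx
  rw [hx, Pi.sub_apply]

lemma outerTangentialTrace_congr (hW : ContDiff ℝ 1 W) (hU : ContDiff ℝ 1 U)
    (hWU : ∀ x ∈ closure Ω, W =ᶠ[𝓝 x] U) (hφ : IsTestFunction Set.univ φ) :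
    outerTangentialTrace Ω W φ = outerTangentialTrace Ω U φ := by
  rw [outerTangentialTrace_of_contDiff hW hφ, outerTangentialTrace_of_contDiff hU hφ,
    setIntegral_congr_fun isClosed_closure.measurableSet fun x hx => ?_]
  simp only [curl_apply, (hWU x hx).fderiv_eq, (hWU x hx).eq_of_nhds]

lemma outerTangentialTraceMemTH_of_contDiff (hΩ : Bornology.IsBounded Ω) (hW : ContDiff ℝ 1 W) :
    OuterTangentialTraceMemTH Ω W := by
  obtain ⟨R, hR0, hR⟩ := hΩ.closure.subset_ball_lt 0 (0 : E3)
  let χ : ContDiffBump (0 : E3) := ⟨R, R + 1, hR0, lt_add_one R⟩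
  have hU : ContDiff ℝ 1 fun x => χ x • W x := χ.contDiff.smul hW
  refine ⟨fun x => χ x • W x, fun i => memH1_univ_of_contDiff ?_ ?_, fun φ hφ =>
    outerTangentialTrace_congr hW hU (fun x hx => ?_) hφ⟩
  · exact (EuclideanSpace.proj (𝕜 := ℝ) i).contDiff.comp hU
  · exact χ.hasCompactSupport.smul_right.comp_left (g := EuclideanSpace.proj (𝕜 := ℝ) i)
      (map_zero _)
  · filter_upwards [χ.eventuallyEq_one_of_mem_ball (hR hx)] with y hy
    rw [hy, Pi.one_apply, one_smul]

lemma memL2Loc_of_continuous (hW : Continuous W) : MemL2Loc W := fun K hK => by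
  have : IsFiniteMeasure (volume.restrict K) := isFiniteMeasure_restrict.2 hK.measure_ne_top
  obtain ⟨c, hc⟩ := hK.exists_bound_of_continuousOn hW.continuousOn
  exact .of_bound hW.aestronglyMeasurable c (ae_restrict_of_forall_mem hK.measurableSet hc)

lemma MemL2Loc.memLp_of_isBounded (hW : MemL2Loc W) (hΩ : Bornology.IsBounded Ω) :
    MemLp W 2 (volume.restrict Ω) :=
  (hW _ hΩ.isCompact_closure).mono_measure (Measure.restrict_mono subset_closure le_rfl)

lemma memB_of_contDiff (hΩ : Bornology.IsBounded Ω) (hW : ContDiff ℝ 1 W)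
    (hcurl : MemLp (curl W) 2 volume) : MemB Ω W where
  memL2Loc := memL2Loc_of_continuous hW.continuous
  exists_weakCurl := ⟨_, isWeakCurl_curl hW⟩
  memL2Loc_curl _ _ := (hcurl.ae_eq (isWeakCurl_curl hW).weakCurl_ae_eq.symm).restrict _
  bounded := by
    obtain ⟨c, hc⟩ := hΩ.isCompact_closure.exists_bound_of_continuousOn hW.continuous.continuousOn
    exact (memLp_top_of_bound hW.continuous.aestronglyMeasurable c
      (ae_restrict_of_forall_mem isClosed_closure.measurableSet hc)).mono_measure
      (Measure.restrict_mono subset_closure le_rfl)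
  memLp_curl := hcurl.ae_eq (isWeakCurl_curl hW).weakCurl_ae_eq.symm
  trace := outerTangentialTraceMemTH_of_contDiff hΩ hW

lemma curl_zero : curl 0 = 0 := by
  ext1 x
  simp [curl_apply]

lemma memB_zero (hΩ : Bornology.IsBounded Ω) : MemB Ω 0 :=
  memB_of_contDiff hΩ contDiff_const (by rw [curl_zero]; exact MemLp.zero)

lemma weakCurl_zero : weakCurl 0 =ᵐ[volume] 0 := by
  simpa only [curl_zero] using (isWeakCurl_curl (W := 0) contDiff_const).weakCurl_ae_eq

end SmoothTestFields

/-! ### Fourth-power integrability of the order parameter -/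

/-- The bounded truncation `s / (1 + ε s²)` of the identity, used as a test function. -/
def truncation (ε s : ℝ) : ℝ := s * (1 + ε * s ^ 2)⁻¹

section Truncation

variable {ε : ℝ}

lemma contDiff_truncation (hε : 0 ≤ ε) : ContDiff ℝ 1 (truncation ε) :=
  contDiff_id.mul (ContDiff.inv (by fun_prop) fun s => by positivity)

lemma deriv_truncation (hε : 0 ≤ ε) (s : ℝ) :
    deriv (truncation ε) s = 2 * (1 + ε * s ^ 2)⁻¹ ^ 2 - (1 + ε * s ^ 2)⁻¹ := by
  have hpos : 1 + ε * s ^ 2 ≠ 0 := by positivity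
  have hdenom : HasDerivAt (fun s : ℝ => 1 + ε * s ^ 2) (ε * (2 * s)) s := by
    simpa using ((hasDerivAt_pow 2 s).const_mul ε).const_add 1
  refine ((hasDerivAt_id s).mul (hdenom.inv hpos)).deriv.trans ?_
  simp only [id, Pi.inv_apply]
  field_simp
  ring

lemma nnnorm_deriv_truncation_le (hε : 0 ≤ ε) (s : ℝ) : ‖deriv (truncation ε) s‖₊ ≤ 1 := by
  have hpos : 0 < (1 + ε * s ^ 2)⁻¹ := by positivity
  have hle : (1 + ε * s ^ 2)⁻¹ ≤ 1 := inv_le_one_of_one_le₀ (le_add_of_nonneg_right (by positivity))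
  rw [← NNReal.coe_le_coe, coe_nnnorm, NNReal.coe_one, Real.norm_eq_abs, deriv_truncation hε,
    abs_le]
  constructor <;> nlinarith

lemma mul_truncation_nonneg (hε : 0 ≤ ε) (s : ℝ) : 0 ≤ s * truncation ε s := by
  rw [truncation, ← mul_assoc]
  exact mul_nonneg (mul_self_nonneg s) (by positivity)

lemma mul_truncation_le (hε : 0 < ε) (s : ℝ) : s * truncation ε s ≤ ε⁻¹ := by
  rw [truncation, ← mul_assoc, ← div_eq_mul_inv, div_le_iff₀ (by positivity), mul_add,
    inv_mul_cancel_left₀ hε.ne', sq]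
  exact le_add_of_nonneg_left (by positivity)

lemma tendsto_truncation (s : ℝ) :
    Tendsto (fun n : ℕ => truncation (1 / (n + 1 : ℝ)) s) atTop (𝓝 s) := by
  have hdenom : Tendsto (fun n : ℕ => 1 + 1 / (n + 1 : ℝ) * s ^ 2) atTop (𝓝 1) := by
    simpa using (tendsto_one_div_add_atTop_nhds_zero_nat.mul_const (s ^ 2)).const_add 1
  simpa [truncation] using (hdenom.inv₀ one_ne_zero).const_mul s

end Truncation

lemma mul_le_sq_of_nnnorm_deriv_le_one {ψ : ℝ → ℝ} (hψ : Differentiable ℝ ψ) (hψ0 : ψ 0 = 0)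
    (hψ' : ∀ s, ‖deriv ψ s‖₊ ≤ 1) (s : ℝ) : s * ψ s ≤ s ^ 2 := by
  have hlip : |ψ s| ≤ |s| := by
    simpa [hψ0] using (lipschitzWith_of_nnnorm_deriv_le hψ hψ').norm_sub_le s 0
  calc s * ψ s ≤ |s| * |ψ s| := (le_abs_self _).trans (abs_mul s _).le
    _ ≤ |s| * |s| := by gcongr
    _ = s ^ 2 := by rw [abs_mul_abs_self, sq]

lemma sq_mul_le_add_weak_integrand {c t d p q a : ℝ} (hc : 0 ≤ c) (hd : -1 ≤ d) (hp : 0 ≤ p)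
    (hpt : p ≤ t ^ 2) :
    t ^ 2 * p ≤ t ^ 2 + c * q ^ 2 + (c * (d * q ^ 2) - (1 - t ^ 2 - a ^ 2) * p) := by
  have hap : 0 ≤ a ^ 2 * p := by positivity
  have hcq : 0 ≤ c * q ^ 2 * (d + 1) := mul_nonneg (by positivity) (by linarith)
  linarith

lemma integrable_mul_self_mul_comp {X : Type*} [MeasurableSpace X] {μ : Measure X} {u f : X → ℝ}
    {ψ : ℝ → ℝ} {C : ℝ} (hu : Integrable u μ) (hf : AEStronglyMeasurable f μ) (hψ : Continuous ψ)
    (hC : ∀ s, ‖s * ψ s‖ ≤ C) : Integrable (fun x => u x * (f x * ψ (f x))) μ :=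
  hu.mul_bdd (hf.mul (hψ.comp_aestronglyMeasurable hf)) (ae_of_all _ fun x => hC (f x))

namespace IsWeakSolution

variable {Ω : Set E3} {lam κ : ℝ} {H A : E3 → E3} {f : E3 → ℝ}

lemma integral_grad_eq_zero (h : IsWeakSolution Ω lam κ H f A) (hΩ : Bornology.IsBounded Ω)
    {g : E3 → ℝ} (hg : MemH1 Ω g) :
    ∫ x in Ω, (lam ^ 2 / κ ^ 2 * ⟪weakGrad Ω f x, weakGrad Ω g x⟫
      - (1 - f x ^ 2 - ‖A x‖ ^ 2) * f x * g x) = 0 := by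
  have heq := h.weak_eq g 0 hg (memB_zero hΩ)
  have hcurl : ∫ x, lam * ⟪lam • weakCurl A x - H x, weakCurl 0 x⟫ = 0 :=
    integral_eq_zero_of_ae (weakCurl_zero.mono fun x hx => by simp [hx])
  simpa only [hcurl, Pi.zero_apply, inner_zero_right, mul_zero, add_zero] using heq

lemma integral_sq_mul_comp_le (h : IsWeakSolution Ω lam κ H f A) (hΩo : IsOpen Ω)
    (hΩb : Bornology.IsBounded Ω) {ψ : ℝ → ℝ} (hψ : ContDiff ℝ 1 ψ) (hψ0 : ψ 0 = 0)
    (hψ' : ∀ s, ‖deriv ψ s‖₊ ≤ 1) (hpos : ∀ s, 0 ≤ s * ψ s) {C : ℝ} (hC : ∀ s, s * ψ s ≤ C) :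
    ∫ x in Ω, f x ^ 2 * (f x * ψ (f x))
      ≤ ∫ x in Ω, (f x ^ 2 + lam ^ 2 / κ ^ 2 * ‖weakGrad Ω f x‖ ^ 2) := by
  have : IsFiniteMeasure (volume.restrict Ω) := isFiniteMeasure_restrict.2 hΩb.measure_lt_top.ne
  have hg : MemH1 Ω (ψ ∘ f) := h.memH1.comp hΩo hψ hψ0 hψ'
  have hgrad := (h.memH1.isWeakGrad.comp hΩo hψ hψ').weakGrad_ae_eq hΩo
  have hmul {u : E3 → ℝ} (hu : Integrable u (volume.restrict Ω)) :
      IntegrableOn (fun x => u x * (f x * ψ (f x))) Ω :=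
    integrable_mul_self_mul_comp hu h.memH1.memLp.1 hψ.continuous
      fun s => (Real.norm_of_nonneg (hpos s)).trans_le (hC s)
  have hf2 : IntegrableOn (fun x => f x ^ 2) Ω := h.memH1.memLp.integrable_sq
  have hG2 : IntegrableOn (fun x => lam ^ 2 / κ ^ 2 * ‖weakGrad Ω f x‖ ^ 2) Ω :=
    (h.memH1.memLp_weakGrad.integrable_norm_pow two_ne_zero).const_mul _
  have hA2 : IntegrableOn (fun x => ‖A x‖ ^ 2) Ω :=
    (h.memA.bounded.mono_exponent le_top).integrable_norm_pow two_ne_zero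
  have hI : IntegrableOn (fun x => lam ^ 2 / κ ^ 2 * ⟪weakGrad Ω f x, weakGrad Ω (ψ ∘ f) x⟫
      - (1 - f x ^ 2 - ‖A x‖ ^ 2) * (f x * ψ (f x))) Ω :=
    ((integrable_inner h.memH1.memLp_weakGrad hg.memLp_weakGrad).const_mul _).sub
      (hmul (((integrable_const 1).sub hf2).sub hA2))
  have hsum : IntegrableOn (fun x => f x ^ 2 + lam ^ 2 / κ ^ 2 * ‖weakGrad Ω f x‖ ^ 2) Ω :=
    hf2.add hG2
  have hI0 := h.integral_grad_eq_zero hΩb hg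
  simp only [mul_assoc, Function.comp_apply] at hI0
  rw [← add_zero (∫ x in Ω, (f x ^ 2 + _)), ← hI0, ← integral_add hsum hI]
  refine integral_mono_ae (hmul hf2) (hsum.add hI) ?_
  filter_upwards [hgrad] with x hx
  rw [hx, inner_smul_right, real_inner_self_eq_norm_sq]
  exact sq_mul_le_add_weak_integrand (by positivity) (abs_le.1 (hψ' (f x))).1 (hpos _)
    (mul_le_sq_of_nnnorm_deriv_le_one (hψ.differentiable one_ne_zero) hψ0 hψ' (f x))

theorem memLp_sq (h : IsWeakSolution Ω lam κ H f A) (hΩo : IsOpen Ω)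
    (hΩb : Bornology.IsBounded Ω) : MemLp (fun x => f x ^ 2) 2 (volume.restrict Ω) := by
  let ψ (n : ℕ) : ℝ → ℝ := truncation (1 / (n + 1))
  have hε (n : ℕ) : 0 < 1 / (n + 1 : ℝ) := by positivity
  have hpos (n : ℕ) (s : ℝ) : 0 ≤ s * ψ n s := mul_truncation_nonneg (hε n).le s
  have hbound (n : ℕ) (s : ℝ) : s * ψ n s ≤ (1 / (n + 1 : ℝ))⁻¹ := mul_truncation_le (hε n) s
  refine (memLp_two_iff_integrable_sq (h.memH1.memLp.1.pow 2)).2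
    (integrable_of_tendsto_of_integral_norm_le
      (K := ∫ x in Ω, (f x ^ 2 + lam ^ 2 / κ ^ 2 * ‖weakGrad Ω f x‖ ^ 2))
      (u := fun n x => f x ^ 2 * (f x * ψ n (f x)))
      (ae_of_all _ fun x => ?_) (fun n => ?_) (fun n => ?_))
  · simpa [sq, ψ] using ((tendsto_truncation (f x)).const_mul (f x)).const_mul (f x * f x)
  · exact integrable_mul_self_mul_comp h.memH1.memLp.integrable_sq h.memH1.memLp.1
      (contDiff_truncation (hε n).le).continuous
      fun s => (Real.norm_of_nonneg (hpos n s)).trans_le (hbound n s)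
  · refine (integral_congr_ae (ae_of_all _ fun x =>
      Real.norm_of_nonneg (mul_nonneg (sq_nonneg (f x)) (hpos n (f x))))).trans_le ?_
    exact h.integral_sq_mul_comp_le hΩo hΩb (contDiff_truncation (hε n).le) (zero_mul _)
      (nnnorm_deriv_truncation_le (hε n).le) (hpos n) (hbound n)

end IsWeakSolution

/-! ### Strict monotonicity at stable states -/

lemma four_thirds_lt_sq_add_sub_norm_add_sq {E : Type*} [SeminormedAddCommGroup E] {f₀ f₁ : ℝ}
    {a₀ a₁ : E} (hf₀ : 0 ≤ f₀) (hf₁ : 0 ≤ f₁) (h₀ : 1 / 3 < f₀ ^ 2 - ‖a₀‖ ^ 2)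
    (h₁ : 1 / 3 < f₁ ^ 2 - ‖a₁‖ ^ 2) : 4 / 3 < (f₀ + f₁) ^ 2 - ‖a₀ + a₁‖ ^ 2 := by
  have hnorm : ‖a₀ + a₁‖ ^ 2 ≤ (‖a₀‖ + ‖a₁‖) ^ 2 := by grw [norm_add_le]
  have hprod : 1 / 3 + ‖a₀‖ * ‖a₁‖ < f₀ * f₁ := by
    refine lt_of_pow_lt_pow_left₀ 2 (by positivity) ?_
    calc (1 / 3 + ‖a₀‖ * ‖a₁‖) ^ 2 ≤ (1 / 3 + ‖a₀‖ ^ 2) * (1 / 3 + ‖a₁‖ ^ 2) := by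
          linarith [sq_nonneg (‖a₀‖ - ‖a₁‖)]
      _ < f₀ ^ 2 * f₁ ^ 2 := by gcongr <;> linarith
      _ = (f₀ * f₁) ^ 2 := (mul_pow ..).symm
  linarith

section Potential

variable {E : Type*} [NormedAddCommGroup E] [InnerProductSpace ℝ E]

/-- The derivative of the potential `(1 - f²)² / 4 + f² |a|² / 2` of the Meissner system at the
state `(f, a)` in the direction `(g, b)`. -/
def potentialDeriv (f : ℝ) (a : E) (g : ℝ) (b : E) : ℝ :=
  -((1 - f ^ 2 - ‖a‖ ^ 2) * f * g) + f ^ 2 * ⟪a, b⟫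

lemma potentialDeriv_sub_eq (f₀ f₁ : ℝ) (a₀ a₁ : E) :
    potentialDeriv f₁ a₁ (f₁ - f₀) (a₁ - a₀) - potentialDeriv f₀ a₀ (f₁ - f₀) (a₁ - a₀) =
      ‖(f₁ - f₀) • (a₀ + a₁) + ((f₀ + f₁) / 2) • (a₁ - a₀)‖ ^ 2
        + (3 / 4 * ((f₀ + f₁) ^ 2 - ‖a₀ + a₁‖ ^ 2) - 1) * (f₁ - f₀) ^ 2
        + (f₁ - f₀) ^ 4 / 4 + (f₁ - f₀) ^ 2 * ‖a₁ - a₀‖ ^ 2 / 2 := by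
  simp only [potentialDeriv, ← real_inner_self_eq_norm_sq, inner_add_left, inner_add_right,
    inner_sub_left, inner_sub_right, real_inner_smul_left, real_inner_smul_right,
    real_inner_comm a₁ a₀]
  ring

variable {f₀ f₁ : ℝ} {a₀ a₁ : E}

lemma potentialDeriv_le_potentialDeriv (hf₀ : 0 ≤ f₀) (hf₁ : 0 ≤ f₁)
    (h₀ : 1 / 3 < f₀ ^ 2 - ‖a₀‖ ^ 2) (h₁ : 1 / 3 < f₁ ^ 2 - ‖a₁‖ ^ 2) :
    potentialDeriv f₀ a₀ (f₁ - f₀) (a₁ - a₀) ≤ potentialDeriv f₁ a₁ (f₁ - f₀) (a₁ - a₀) := by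
  have hmid := four_thirds_lt_sq_add_sub_norm_add_sq hf₀ hf₁ h₀ h₁
  have hcoeff : 0 ≤ 3 / 4 * ((f₀ + f₁) ^ 2 - ‖a₀ + a₁‖ ^ 2) - 1 := by linarith
  rw [← sub_nonneg, potentialDeriv_sub_eq]
  positivity

lemma eq_of_potentialDeriv_eq (hf₀ : 0 ≤ f₀) (hf₁ : 0 ≤ f₁)
    (h₀ : 1 / 3 < f₀ ^ 2 - ‖a₀‖ ^ 2) (h₁ : 1 / 3 < f₁ ^ 2 - ‖a₁‖ ^ 2)
    (h : potentialDeriv f₀ a₀ (f₁ - f₀) (a₁ - a₀) = potentialDeriv f₁ a₁ (f₁ - f₀) (a₁ - a₀)) :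
    f₀ = f₁ ∧ a₀ = a₁ := by
  have hmid := four_thirds_lt_sq_add_sub_norm_add_sq hf₀ hf₁ h₀ h₁
  have hcoeff : 0 < 3 / 4 * ((f₀ + f₁) ^ 2 - ‖a₀ + a₁‖ ^ 2) - 1 := by linarith
  have hsum := potentialDeriv_sub_eq f₀ f₁ a₀ a₁
  rw [h, sub_self] at hsum
  have hf : f₁ = f₀ := by
    refine sub_eq_zero.1 (pow_eq_zero_iff two_ne_zero |>.1 ?_)
    refine (mul_eq_zero_iff_left hcoeff.ne').1 (le_antisymm ?_ (by positivity))
    have hrest : 0 ≤ ‖(f₁ - f₀) • (a₀ + a₁) + ((f₀ + f₁) / 2) • (a₁ - a₀)‖ ^ 2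
        + (f₁ - f₀) ^ 4 / 4 + (f₁ - f₀) ^ 2 * ‖a₁ - a₀‖ ^ 2 / 2 := by positivity
    linarith
  have hf₁0 : f₁ ≠ 0 := by
    rintro rfl
    linarith [sq_nonneg ‖a₁‖]
  have ha : ‖f₁ • (a₁ - a₀)‖ ^ 2 = 0 := by simpa [hf] using hsum.symm
  exact ⟨hf.symm, by simpa [hf₁0, sub_eq_zero, eq_comm] using ha⟩

end Potential

/-! ### Uniqueness -/

/-- The integrand over `Ω` of the weak equation for `(f, A)`, tested with `(g, B)`. -/
def bulkIntegrand (Ω : Set E3) (lam κ : ℝ) (f : E3 → ℝ) (A : E3 → E3) (g : E3 → ℝ) (B : E3 → E3)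
    (x : E3) : ℝ :=
  lam ^ 2 / κ ^ 2 * ⟪weakGrad Ω f x, weakGrad Ω g x⟫ + potentialDeriv (f x) (A x) (g x) (B x)

namespace IsWeakSolution

variable {Ω : Set E3} {lam κ : ℝ} {H A B C : E3 → E3} {f g : E3 → ℝ}

lemma memLp_smul_weakCurl_sub (h : IsWeakSolution Ω lam κ H f A) (hlam : lam ≠ 0) :
    MemLp (fun x => lam • weakCurl A x - H x) 2 := by
  simpa [Pi.smul_def, smul_sub, smul_inv_smul₀ hlam] using h.memA.memLp_sub.const_smul lam

lemma memLp_sq_smul (h : IsWeakSolution Ω lam κ H f A) (hΩo : IsOpen Ω)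
    (hΩb : Bornology.IsBounded Ω) : MemLp (fun x => f x ^ 2 • A x) 2 (volume.restrict Ω) :=
  h.memA.bounded.smul (h.memLp_sq hΩo hΩb)

lemma integrableOn_bulkIntegrand (h : IsWeakSolution Ω lam κ H f A) (hΩo : IsOpen Ω)
    (hΩb : Bornology.IsBounded Ω) (hg : MemH1 Ω g) (hfg : MemLp (f * g) 2 (volume.restrict Ω))
    (hB : MemLp B 2 (volume.restrict Ω)) : IntegrableOn (bulkIntegrand Ω lam κ f A g B) Ω := by
  have : IsFiniteMeasure (volume.restrict Ω) := isFiniteMeasure_restrict.2 hΩb.measure_lt_top.ne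
  have hA2 : MemLp (fun x => ‖A x‖ * ‖A x‖) ⊤ (volume.restrict Ω) :=
    h.memA.bounded.norm.mul h.memA.bounded.norm
  have hcoeff : MemLp (fun x => 1 - f x ^ 2 - ‖A x‖ * ‖A x‖) 2 (volume.restrict Ω) :=
    ((memLp_const 1).sub (h.memLp_sq hΩo hΩb)).sub (hA2.mono_exponent le_top)
  have hgrad := (integrable_inner h.memH1.memLp_weakGrad hg.memLp_weakGrad).const_mul
    (lam ^ 2 / κ ^ 2)
  refine (hgrad.add ((hcoeff.integrable_mul hfg).neg.add
    (integrable_inner (h.memLp_sq_smul hΩo hΩb) hB))).congr (ae_of_all _ fun x => ?_)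
  simp only [bulkIntegrand, potentialDeriv, Pi.add_apply, Pi.neg_apply, Pi.mul_apply,
    real_inner_smul_left]
  ring

lemma integral_bulkIntegrand_eq_add (h : IsWeakSolution Ω lam κ H f A) (hΩo : IsOpen Ω)
    (hΩb : Bornology.IsBounded Ω) (hg : MemH1 Ω g) (hfg : MemLp (f * g) 2 (volume.restrict Ω))
    (hB : MemLp B 2 (volume.restrict Ω)) :
    ∫ x in Ω, bulkIntegrand Ω lam κ f A g B x
      = (∫ x in Ω, bulkIntegrand Ω lam κ f A g 0 x) + ∫ x in Ω, ⟪f x ^ 2 • A x, B x⟫ := by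
  rw [← integral_add (h.integrableOn_bulkIntegrand hΩo hΩb hg hfg MemLp.zero)
    (integrable_inner (h.memLp_sq_smul hΩo hΩb) hB)]
  simp only [bulkIntegrand, potentialDeriv, Pi.zero_apply, inner_zero_right, mul_zero, add_zero,
    real_inner_smul_left, add_assoc]

lemma weak_eq_of_contDiff (h : IsWeakSolution Ω lam κ H f A) (hΩb : Bornology.IsBounded Ω)
    (hg : MemH1 Ω g) (hB : ContDiff ℝ 1 B) (hcurl : MemLp (curl B) 2) :
    (∫ x in Ω, bulkIntegrand Ω lam κ f A g B x)
      + lam * ∫ x, ⟪lam • weakCurl A x - H x, curl B x⟫ = 0 := by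
  rw [← h.weak_eq g B hg (memB_of_contDiff hΩb hB hcurl), ← integral_const_mul]
  congr 1
  · simp only [bulkIntegrand, potentialDeriv, sub_eq_add_neg, add_assoc]
  · refine integral_congr_ae ?_
    filter_upwards [(isWeakCurl_curl hB).weakCurl_ae_eq] with x hx
    rw [hx]

theorem weak_eq_of_isWeakCurl (h : IsWeakSolution Ω lam κ H f A) (hΩo : IsOpen Ω)
    (hΩb : Bornology.IsBounded Ω) (hlam : lam ≠ 0) (hg : MemH1 Ω g)
    (hfg : MemLp (f * g) 2 (volume.restrict Ω)) (hB : MemL2Loc B) (hBC : IsWeakCurl B C)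
    (hC : MemLp C 2) :
    (∫ x in Ω, bulkIntegrand Ω lam κ f A g B x)
      + lam * ∫ x, ⟪lam • weakCurl A x - H x, C x⟫ = 0 := by
  obtain ⟨φ, hφ, -⟩ := exists_bump_tendsto_zero E3
  have hsmooth (n : ℕ) : ContDiff ℝ 1 (mollify (φ n) B) :=
    (contDiff_mollify hBC.locInt).of_le (by simp)
  have hcurl (n : ℕ) : MemLp (mollify (φ n) C) 2 := memLp_mollify one_le_two (by simp) hC
  have hBΩ := hB.memLp_of_isBounded hΩb
  have hBn (n : ℕ) : MemLp (mollify (φ n) B) 2 (volume.restrict Ω) :=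
    (memL2Loc_of_continuous (hsmooth n).continuous).memLp_of_isBounded hΩb
  have hlimΩ := tendsto_integral_inner (h.memLp_sq_smul hΩo hΩb) hBΩ hBn
    (tendsto_eLpNorm_mollify_sub_restrict hφ one_le_two (by simp) hΩo.measurableSet one_pos
      (hB.memLp_of_isBounded hΩb.cthickening))
  have hlim := tendsto_integral_inner (h.memLp_smul_weakCurl_sub hlam) hC hcurl
    (tendsto_eLpNorm_mollify_sub hφ one_le_two (by simp) hC)
  rw [h.integral_bulkIntegrand_eq_add hΩo hΩb hg hfg hBΩ]
  refine tendsto_nhds_unique ((hlimΩ.const_add _).add (hlim.const_mul lam))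
    (tendsto_const_nhds.congr fun n => ?_)
  rw [← h.integral_bulkIntegrand_eq_add hΩo hΩb hg hfg (hBn n), ← hBC.curl_mollify,
    h.weak_eq_of_contDiff hΩb hg (hsmooth n) (by rw [hBC.curl_mollify]; exact hcurl n)]

lemma memLp_mul {A' : E3 → E3} {f' : E3 → ℝ} (h : IsWeakSolution Ω lam κ H f A)
    (h' : IsWeakSolution Ω lam κ H f' A') (hΩo : IsOpen Ω) (hΩb : Bornology.IsBounded Ω) :
    MemLp (f * f') 2 (volume.restrict Ω) := by
  refine ((h.memLp_sq hΩo hΩb).add (h'.memLp_sq hΩo hΩb)).of_le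
    (h.memH1.memLp.1.mul h'.memH1.memLp.1) (ae_of_all _ fun x => ?_)
  rw [Pi.mul_apply, Pi.add_apply, Real.norm_eq_abs, Real.norm_of_nonneg (by positivity), abs_le]
  constructor <;> nlinarith [sq_nonneg (f x + f' x), sq_nonneg (f x - f' x)]

variable {A₀ A₁ : E3 → E3} {f₀ f₁ : E3 → ℝ}

lemma memLp_mul_sub (h₀ : IsWeakSolution Ω lam κ H f₀ A₀) (h₁ : IsWeakSolution Ω lam κ H f₁ A₁)
    (h : IsWeakSolution Ω lam κ H f A) (hΩo : IsOpen Ω) (hΩb : Bornology.IsBounded Ω) :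
    MemLp (f * (f₁ - f₀)) 2 (volume.restrict Ω) := by
  rw [mul_sub]
  exact (h.memLp_mul h₁ hΩo hΩb).sub (h.memLp_mul h₀ hΩo hΩb)

lemma memL2Loc_sub (h₀ : IsWeakSolution Ω lam κ H f₀ A₀) (h₁ : IsWeakSolution Ω lam κ H f₁ A₁) :
    MemL2Loc (A₁ - A₀) :=
  fun K hK => (h₁.memA.memL2Loc K hK).sub (h₀.memA.memL2Loc K hK)

lemma memLp_weakCurl_sub (h₀ : IsWeakSolution Ω lam κ H f₀ A₀)
    (h₁ : IsWeakSolution Ω lam κ H f₁ A₁) : MemLp (weakCurl A₁ - weakCurl A₀) 2 := by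
  simpa [Pi.sub_def] using h₁.memA.memLp_sub.sub h₀.memA.memLp_sub

lemma integrableOn_bulkIntegrand_sub (h₀ : IsWeakSolution Ω lam κ H f₀ A₀)
    (h₁ : IsWeakSolution Ω lam κ H f₁ A₁) (h : IsWeakSolution Ω lam κ H f A) (hΩo : IsOpen Ω)
    (hΩb : Bornology.IsBounded Ω) :
    IntegrableOn (bulkIntegrand Ω lam κ f A (f₁ - f₀) (A₁ - A₀)) Ω :=
  h.integrableOn_bulkIntegrand hΩo hΩb (h₁.memH1.sub hΩo h₀.memH1)
    (h₀.memLp_mul_sub h₁ h hΩo hΩb) ((h₀.memL2Loc_sub h₁).memLp_of_isBounded hΩb)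

lemma weak_eq_sub (h₀ : IsWeakSolution Ω lam κ H f₀ A₀) (h₁ : IsWeakSolution Ω lam κ H f₁ A₁)
    (h : IsWeakSolution Ω lam κ H f A) (hΩo : IsOpen Ω) (hΩb : Bornology.IsBounded Ω)
    (hlam : lam ≠ 0) :
    (∫ x in Ω, bulkIntegrand Ω lam κ f A (f₁ - f₀) (A₁ - A₀) x)
      + lam * ∫ x, ⟪lam • weakCurl A x - H x, (weakCurl A₁ - weakCurl A₀) x⟫ = 0 :=
  h.weak_eq_of_isWeakCurl hΩo hΩb hlam (h₁.memH1.sub hΩo h₀.memH1)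
    (h₀.memLp_mul_sub h₁ h hΩo hΩb) (h₀.memL2Loc_sub h₁)
    ((isWeakCurl_weakCurl h₁.memA.exists_weakCurl).sub
      (isWeakCurl_weakCurl h₀.memA.exists_weakCurl)) (h₀.memLp_weakCurl_sub h₁)

theorem integral_bulkIntegrand_sub_add_eq_zero (h₀ : IsWeakSolution Ω lam κ H f₀ A₀)
    (h₁ : IsWeakSolution Ω lam κ H f₁ A₁) (hΩo : IsOpen Ω) (hΩb : Bornology.IsBounded Ω)
    (hlam : lam ≠ 0) :
    (∫ x in Ω, (bulkIntegrand Ω lam κ f₁ A₁ (f₁ - f₀) (A₁ - A₀) x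
        - bulkIntegrand Ω lam κ f₀ A₀ (f₁ - f₀) (A₁ - A₀) x))
      + lam ^ 2 * ∫ x, ‖(weakCurl A₁ - weakCurl A₀) x‖ ^ 2 = 0 := by
  have hC := h₀.memLp_weakCurl_sub h₁
  have hcurl : lam * ∫ x, ‖(weakCurl A₁ - weakCurl A₀) x‖ ^ 2
      = (∫ x, ⟪lam • weakCurl A₁ x - H x, (weakCurl A₁ - weakCurl A₀) x⟫)
        - ∫ x, ⟪lam • weakCurl A₀ x - H x, (weakCurl A₁ - weakCurl A₀) x⟫ := by
    rw [← integral_sub (integrable_inner (h₁.memLp_smul_weakCurl_sub hlam) hC)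
      (integrable_inner (h₀.memLp_smul_weakCurl_sub hlam) hC), ← integral_const_mul]
    refine integral_congr_ae (ae_of_all _ fun x => ?_)
    simp only [← real_inner_self_eq_norm_sq, Pi.sub_apply, inner_sub_left, real_inner_smul_left]
    ring
  rw [integral_sub (h₀.integrableOn_bulkIntegrand_sub h₁ h₁ hΩo hΩb)
    (h₀.integrableOn_bulkIntegrand_sub h₁ h₀ hΩo hΩb)]
  linear_combination h₀.weak_eq_sub h₁ h₁ hΩo hΩb hlam - h₀.weak_eq_sub h₁ h₀ hΩo hΩb hlam
    + lam * hcurl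

lemma potentialDeriv_sub_le_bulkIntegrand_sub (h₀ : IsWeakSolution Ω lam κ H f₀ A₀)
    (h₁ : IsWeakSolution Ω lam κ H f₁ A₁) (hΩo : IsOpen Ω) :
    ∀ᵐ x ∂volume.restrict Ω,
      potentialDeriv (f₁ x) (A₁ x) (f₁ x - f₀ x) (A₁ x - A₀ x)
          - potentialDeriv (f₀ x) (A₀ x) (f₁ x - f₀ x) (A₁ x - A₀ x)
        ≤ bulkIntegrand Ω lam κ f₁ A₁ (f₁ - f₀) (A₁ - A₀) x
          - bulkIntegrand Ω lam κ f₀ A₀ (f₁ - f₀) (A₁ - A₀) x := by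
  filter_upwards [(h₁.memH1.isWeakGrad.sub h₀.memH1.isWeakGrad).weakGrad_ae_eq hΩo] with x hx
  have hgrad : 0 ≤ lam ^ 2 / κ ^ 2 * ⟪weakGrad Ω f₁ x - weakGrad Ω f₀ x,
      weakGrad Ω f₁ x - weakGrad Ω f₀ x⟫ := mul_nonneg (by positivity) real_inner_self_nonneg
  rw [inner_sub_left, mul_sub] at hgrad
  simp only [bulkIntegrand, hx, Pi.sub_apply]
  linarith

end IsWeakSolution

lemma IsWeakMeissnerSolution.ae_nonneg {Ω : Set E3} {lam κ : ℝ} {H A : E3 → E3} {f : E3 → ℝ}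
    (h : IsWeakMeissnerSolution Ω lam κ H f A) : ∀ᵐ x ∂volume.restrict Ω, 0 ≤ f x :=
  let ⟨_, hc, hf⟩ := h.pos
  hf.mono fun _ => hc.le.trans

lemma StabilityCondition.ae_lt {Ω : Set E3} {f : E3 → ℝ} {A : E3 → E3}
    (h : StabilityCondition Ω f A) : ∀ᵐ x ∂volume.restrict Ω, 1 / 3 < f x ^ 2 - ‖A x‖ ^ 2 :=
  let ⟨_, hc, hf⟩ := h
  hf.mono fun _ => hc.trans_le

end Meissner

end

open Meissner in
theorem lemma3p11_general {Ω : Set E3} (hΩo : IsOpen Ω) (hΩb : Bornology.IsBounded Ω)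
    {lam κ : ℝ} (hlam : lam ≠ 0) (hκ : κ ≠ 0) {H : E3 → E3} {f₀ f₁ : E3 → ℝ} {A₀ A₁ : E3 → E3}
    (h₀ : IsWeakSolution Ω lam κ H f₀ A₀) (h₁ : IsWeakSolution Ω lam κ H f₁ A₁)
    (hf₀ : ∀ᵐ x ∂volume.restrict Ω, 0 ≤ f₀ x) (hf₁ : ∀ᵐ x ∂volume.restrict Ω, 0 ≤ f₁ x)
    (hs₀ : ∀ᵐ x ∂volume.restrict Ω, 1 / 3 < f₀ x ^ 2 - ‖A₀ x‖ ^ 2)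
    (hs₁ : ∀ᵐ x ∂volume.restrict Ω, 1 / 3 < f₁ x ^ 2 - ‖A₁ x‖ ^ 2) :
    (∀ᵐ x ∂volume.restrict Ω, f₀ x = f₁ x ∧ A₀ x = A₁ x) ∧ weakCurl A₀ =ᵐ[volume] weakCurl A₁ := by
  let bulkGap : E3 → ℝ := bulkIntegrand Ω lam κ f₁ A₁ (f₁ - f₀) (A₁ - A₀)
    - bulkIntegrand Ω lam κ f₀ A₀ (f₁ - f₀) (A₁ - A₀)
  have hle := h₀.potentialDeriv_sub_le_bulkIntegrand_sub h₁ hΩo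
  have hgap : 0 ≤ᵐ[volume.restrict Ω] bulkGap := by
    filter_upwards [hf₀, hf₁, hs₀, hs₁, hle] with x hf₀ hf₁ hs₀ hs₁ hle
    exact (sub_nonneg.2 (potentialDeriv_le_potentialDeriv hf₀ hf₁ hs₀ hs₁)).trans hle
  have hcurl : 0 ≤ fun x => ‖(weakCurl A₁ - weakCurl A₀) x‖ ^ 2 := fun x => sq_nonneg _
  obtain ⟨hgap0, hcurl0⟩ := (add_eq_zero_iff_of_nonneg (integral_nonneg_of_ae hgap)
    (mul_nonneg (sq_nonneg lam) (integral_nonneg hcurl))).1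
    (h₀.integral_bulkIntegrand_sub_add_eq_zero h₁ hΩo hΩb hlam)
  rw [integral_eq_zero_iff_of_nonneg_ae hgap ((h₀.integrableOn_bulkIntegrand_sub h₁ h₁ hΩo hΩb).sub
    (h₀.integrableOn_bulkIntegrand_sub h₁ h₀ hΩo hΩb))] at hgap0
  rw [mul_eq_zero_iff_left (pow_ne_zero 2 hlam), integral_eq_zero_iff_of_nonneg hcurl
    ((h₀.memLp_weakCurl_sub h₁).integrable_norm_pow two_ne_zero)] at hcurl0
  constructor
  · filter_upwards [hf₀, hf₁, hs₀, hs₁, hle, hgap0] with x hf₀ hf₁ hs₀ hs₁ hle hgap0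
    exact eq_of_potentialDeriv_eq hf₀ hf₁ hs₀ hs₁
      ((potentialDeriv_le_potentialDeriv hf₀ hf₁ hs₀ hs₁).antisymm
        (sub_nonpos.1 (hle.trans_eq hgap0)))
  · filter_upwards [hcurl0] with x hx
    have hx' : weakCurl A₁ x - weakCurl A₀ x = 0 := by simpa using hx
    exact (sub_eq_zero.1 hx').symm

theorem lemma3p11 (Ω : Set Meissner.E3) (hΩ : Meissner.IsBoundedC2Domain Ω)
    (lam κ : ℝ) (hlam : 0 < lam) (hκ : 0 < κ)
    (α : NNReal) (hα0 : 0 < α) (hα1 : α < 1)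
    (H : Meissner.E3 → Meissner.E3) (hH : Meissner.AppliedFieldCondition Ω α H)
    (f₀ f₁ : Meissner.E3 → ℝ) (A₀ A₁ : Meissner.E3 → Meissner.E3)
    (h₀ : Meissner.IsWeakMeissnerSolution Ω lam κ H f₀ A₀)
    (h₁ : Meissner.IsWeakMeissnerSolution Ω lam κ H f₁ A₁)
    (hs₀ : Meissner.StabilityCondition Ω f₀ A₀)
    (hs₁ : Meissner.StabilityCondition Ω f₁ A₁) :
    (∀ᵐ x ∂(MeasureTheory.volume.restrict Ω), f₀ x = f₁ x ∧ A₀ x = A₁ x) ∧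
      ∀ᵐ x ∂(MeasureTheory.volume.restrict (Meissner.exterior Ω)),
        Meissner.weakCurl A₀ x = Meissner.weakCurl A₁ x := by
  obtain ⟨h, hcurl⟩ := lemma3p11_general hΩ.isOpen hΩ.isBounded hlam.ne' hκ.ne'
    h₀.toIsWeakSolution h₁.toIsWeakSolution h₀.ae_nonneg h₁.ae_nonneg hs₀.ae_lt hs₁.ae_lt
  exact ⟨h, MeasureTheory.ae_restrict_of_ae hcurl⟩
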